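/- Let $\mathcal X,\mathcal M,\mathcal M',\hat{\mathcal X}$ be finite sets ($\hat{\mathcal X}\neq\emptyset$), $T(x'|x)$ a transition kernel on $\mathcal X$ (the Markov source $(X_t)_{t\ge 0}$), $O(m'|m)$ a kernel from $\mathcal M$ to $\mathcal M'$ (the memoryless channel), $d:\mathcal X\times\hat{\mathcal X}\to[0,\infty)$ a distortion function and $\beta\in(0,1)$. Let $\mathcal P(\mathcal X)$ be the set of probability vectors on $\mathcal X$, $\mathcal Q$ the set of all maps $Q:\mathcal X\to\mathcal M$ (quantizers), and $O_Q(m'|x)=O(m'|Q(x))$. *Zero-delay coding problem.* An encoder policy $\gamma^e$ chooses $M_t=\gamma^e_t(X_{[0,t]},M_{[0,t-1]},M'_{[0,t-1]})$, a decoder policy $\gamma^d$ chooses $\hat X_t=\gamma^d_t(M'_{[0,t]})$, where $X_0\sim\pi_0$ and $M'_t\sim O(\cdot|M_t)$. The discounted distortion is $D_\beta(\pi_0,\gamma^e,\gamma^d)=\mathbf E\big[\sum_{t\ge0}\beta^t d(X_t,\hat X_t)\big]$; put $D_\beta(\pi_0,\gamma^e)=\inf_{\gamma^d}D_\beta(\pi_0,\gamma^e,\gamma^d)$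 and $D^*_\beta(\pi_0)=\inf_{\gamma^e}D_\beta(\pi_0,\gamma^e)$. *Belief MDP.* Its state space is $\mathcal P(\mathcal X)$ and its action space is $\mathcal Q$. From $(\pi,Q)$, a symbol $m'$ is drawn with probability $\sum_x O_Q(m'|x)\pi(x)$ and the next state is $\pi'(x')=\sum_x T(x'|x)\bar\pi(x)$, where $\bar\pi(x)=O_Q(m'|x)\pi(x)/\sum_y O_Q(m'|y)\pi(y)$; this defines the transition kernel $P(d\pi'|\pi,Q)$. The cost is $c(\pi,Q)=\sum_{m'}\min_{\hat x}\sum_x d(x,\hat x)O_Q(m'|x)\pi(x)$. For any MDP, $J_\beta(z_0,f)=\mathbf E^f_{z_0}\big[\sum_t\beta^tc(Z_t,U_t)\big]$ is the discounted cost of a (history-dependent, measurable) policy $U_t=f_t(Z_{[0,t]},U_{[0,t-1]})$, and $J^*_\beta(z_0)=\inf_fJ_\beta(z_0,f)$. A map $\gamma:\mathcal P(\mathcal X)\to\mathcal Q$ is identified with the stationary policy $Q_t=\gamma(\pi_t)$ of the belief MDP, and also with the encoder $M_t=\gamma(\pi_t)(X_t)$, where $\pi_t$ is computed from $\pi_0$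 and $M'_{[0,t-1]}$ by the above update. *Quantization.* For $N\ge1$ let $\mathcal P_N(\mathcal X)$ be the finite set of $\pi\in\mathcal P(\mathcal X)$ with $\pi(x)=k_x/N$, $k_x\in\{0,\dots,N\}$, $\sum_{x}k_x=N$. Let $\pi\mapsto\hat\pi\in\mathcal P_N(\mathcal X)$ be any measurable nearest-neighbor map for the Euclidean distance (ties broken arbitrarily), with bins $B_{N,i}=\{\pi:\hat\pi=z_{N,i}\}$ where $\mathcal P_N(\mathcal X)=\{z_{N,i}\}_i$. Let $\nu_N$ be any probability measure on $\mathcal P(\mathcal X)$ with $\nu_N(B_{N,i})>0$ for all $i$, and let $\nu_{N,i}=\nu_N(\cdot\cap B_{N,i})/\nu_N(B_{N,i})$. Let $\mathrm{MDP}_N=(\mathcal P_N(\mathcal X),\mathcal Q,P_N,c_N)$, where $$P_N(z_{N,j}|z_{N,i},Q)=\int_{B_{N,i}}P(B_{N,j}|\pi,Q)\,\nu_{N,i}(d\pi),\qquad c_N(z_{N,i},Q)=\int_{B_{N,i}}c(\pi,Q)\,\nu_{N,i}(d\pi).$$ For every $N\ge1$ let $\hat\gamma^*_N:\mathcal P_N(\mathcal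 X)\to\mathcal Q$ be a stationary policy that is optimal for $\mathrm{MDP}_N$ (it attains the optimal $\beta$-discounted cost from every initial state), and let $\tilde\gamma^*_N(\pi)=\hat\gamma^*_N(\hat\pi)$. Then for all $\pi_0\in\mathcal P(\mathcal X)$, the quantities $J_\beta(\pi_0,\tilde\gamma^*_N)$ and $J^*_\beta(\pi_0)$ are finite and $$\lim_{N\to\infty}\big|J_\beta(\pi_0,\tilde\gamma^*_N)-J^*_\beta(\pi_0)\big|=0.$$ Moreover, $\tilde\gamma^*_N$ is near-optimal for the zero-delay coding problem: for every $\varepsilon>0$, $D_\beta(\pi_0,\tilde\gamma^*_N)\le D^*_\beta(\pi_0)+\varepsilon$ for all sufficiently large $N$. -/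

import Mathlib

open MeasureTheory ProbabilityTheory Filter Topology
open scoped NNReal ENNReal

noncomputable section

/-! ### Markov decision processes with discounted cost -/

/-- A Markov decision process with state space `Z` and action space `U`: a transition kernel
`P(dz' | z, u)` and a measurable cost `c(z, u) ∈ [0, ∞)`. -/
structure MDP (Z U : Type*) [MeasurableSpace Z] [MeasurableSpace U] where
  P : Kernel (Z × U) Z
  markov : IsMarkovKernel P
  cost : Z × U → ℝ
  cost_nonneg : ∀ zu, 0 ≤ cost zu
  measurable_cost : Measurable cost

/-- A (history dependent) policy: `U_t = f_t(Z_{[0,t]}, U_{[0,t-1]})`. -/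
structure Policy (Z U : Type*) [MeasurableSpace Z] [MeasurableSpace U] where
  act : ∀ t : ℕ, (Fin (t + 1) → Z) × (Fin t → U) → U
  measurable_act : ∀ t, Measurable (act t)

/-- The stationary policy `U_t = g(Z_t)`. -/
def Policy.stationary {Z U : Type*} [MeasurableSpace Z] [MeasurableSpace U]
    (g : Z → U) (hg : Measurable g) : Policy Z U where
  act _ h := g (h.1 (Fin.last _))
  measurable_act t := hg.comp ((measurable_pi_apply _).comp measurable_fst)

namespace MDP

variable {Z U : Type*} [MeasurableSpace Z] [MeasurableSpace U]

/-- From the history `(z_i, u_i)_{i ≤ t}` and the new state `z_{t+1} = z'`, form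
`(z_{t+1}, u_{t+1})` where `u_{t+1}` is the action prescribed by the policy. -/
def extendHistory (f : Policy Z U) (t : ℕ)
    (p : ((_ : Finset.Iic t) → Z × U) × Z) : Z × U :=
  (p.2, f.act (t + 1)
    (Fin.snoc (α := fun _ => Z)
        (fun i : Fin (t + 1) => (p.1 ⟨i, Finset.mem_Iic.2 (Nat.lt_succ_iff.1 i.2)⟩).1) p.2,
      fun i : Fin (t + 1) => (p.1 ⟨i, Finset.mem_Iic.2 (Nat.lt_succ_iff.1 i.2)⟩).2))

theorem measurable_extendHistory (f : Policy Z U) (t : ℕ) :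
    Measurable (extendHistory f t) := by
  refine measurable_snd.prodMk ((f.measurable_act (t + 1)).comp (Measurable.prodMk ?_ ?_))
  · refine measurable_pi_lambda _ fun i => ?_
    refine Fin.lastCases ?_ (fun j => ?_) i
    · simpa using measurable_snd
    · simp only [Fin.snoc_castSucc]
      exact measurable_fst.comp ((measurable_pi_apply _).comp measurable_fst)
  · refine measurable_pi_lambda _ fun i => ?_
    exact measurable_snd.comp ((measurable_pi_apply _).comp measurable_fst)

/-- Conditional law of `(Z_{t+1}, U_{t+1})` given the history up to time `t`:
`Z_{t+1} ∼ P(· | Z_t, U_t)` and `U_{t+1}` is chosen by the policy. -/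
def stepKernel (M : MDP Z U) (f : Policy Z U) (t : ℕ) :
    Kernel ((_ : Finset.Iic t) → Z × U) (Z × U) :=
  (Kernel.id ×ₖ (M.P.comap (fun h => h ⟨t, Finset.mem_Iic.2 le_rfl⟩)
    (measurable_pi_apply _))).map (extendHistory f t)

instance (M : MDP Z U) (f : Policy Z U) (t : ℕ) : IsMarkovKernel (M.stepKernel f t) := by
  have := M.markov
  exact Kernel.IsMarkovKernel.map _ (measurable_extendHistory f t)

/-- Law of the state-action process `(Z_t, U_t)_{t ≥ 0}` with `Z_0 = z₀` under the policy `f`. -/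
def processLaw (M : MDP Z U) (f : Policy Z U) (z₀ : Z) : Measure (ℕ → Z × U) :=
  Kernel.trajMeasure (X := fun _ => Z × U)
    (Measure.dirac (z₀, f.act 0 (fun _ => z₀, Fin.elim0))) (M.stepKernel f)

/-- `J_β(z₀, f) = E^f_{z₀} [∑ β^t c(Z_t, U_t)]`, as an element of `[0, ∞]`. -/
def discountedCost (M : MDP Z U) (β : ℝ) (z₀ : Z) (f : Policy Z U) : ℝ≥0∞ :=
  ∫⁻ ω, ∑' t : ℕ, ENNReal.ofReal (β ^ t * M.cost (ω t)) ∂(M.processLaw f z₀)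

/-- `J*_β(z₀)`: the infimum of `J_β(z₀, f)` over all policies `f`. -/
def optimalCost (M : MDP Z U) (β : ℝ) (z₀ : Z) : ℝ≥0∞ :=
  ⨅ f : Policy Z U, M.discountedCost β z₀ f

/-- A policy is optimal if it attains `J*_β(z₀)` for every initial state `z₀`. -/
def IsOptimal (M : MDP Z U) (β : ℝ) (f : Policy Z U) : Prop :=
  ∀ z₀, M.discountedCost β z₀ f = M.optimalCost β z₀

/-- The finite-state approximation of an MDP (with bounded cost) induced by a measurable map `q`
from `Z` to a finite set `G`, with bins `B_i = q⁻¹{i}`, and a probability measure `ν` charging all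
bins. With `ν_i = ν(· ∩ B_i) / ν(B_i)`,
`P_N(j | i, u) = ∫_{B_i} P(B_j | z, u) ν_i(dz)` and `c_N(i, u) = ∫_{B_i} c(z, u) ν_i(dz)`. -/
def quantize {G : Type*} [Fintype G] [MeasurableSpace G] [MeasurableSingletonClass G]
    [Countable U] [MeasurableSingletonClass U] (M : MDP Z U)
    (q : Z → G) (hq : Measurable q) (ν : Measure Z) [IsProbabilityMeasure ν]
    (hν : ∀ i, 0 < ν (q ⁻¹' {i})) : MDP G U where
  P :=
    { toFun := fun iu => ∑ j : G,
        (∫⁻ z, M.P (z, iu.2) (q ⁻¹' {j}) ∂(ν[|q ⁻¹' {iu.1}])) • Measure.dirac j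
      measurable' := Measurable.of_discrete }
  markov := by
    refine ⟨fun iu => ⟨?_⟩⟩
    have := M.markov
    have h1 : IsProbabilityMeasure (ν[|q ⁻¹' {iu.1}]) :=
      cond_isProbabilityMeasure (hν iu.1).ne'
    have hmeas : ∀ j : G, Measurable fun z => M.P (z, iu.2) (q ⁻¹' {j}) := fun j =>
      (M.P.measurable_coe (hq (measurableSet_singleton j))).comp
        (measurable_id.prodMk measurable_const)
    have hsum : ∀ z, ∑ j : G, M.P (z, iu.2) (q ⁻¹' {j}) = 1 := by
      intro z
      have h := sum_measure_preimage_singleton (μ := M.P (z, iu.2)) (f := q) Finset.univ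
        (fun j _ => hq (measurableSet_singleton j))
      simpa using h
    simp only [Kernel.coe_mk, Measure.coe_finsetSum, Finset.sum_apply, Measure.smul_apply,
      measure_univ, smul_eq_mul, mul_one]
    rw [← lintegral_finsetSum _ fun j _ => hmeas j]
    simp [hsum]
  cost := fun iu => ∫ z, M.cost (z, iu.2) ∂(ν[|q ⁻¹' {iu.1}])
  cost_nonneg := fun iu => integral_nonneg fun z => M.cost_nonneg _
  measurable_cost := Measurable.of_discrete

end MDP

/-! ### The zero-delay coding problem and its belief MDP

Beliefs, i.e. elements of `𝒫(𝒳)` for a finite alphabet `𝒳`, are points of `stdSimplex ℝ 𝒳`, with the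
σ-algebra inherited from `ℝ^𝒳`. The source kernel is `T x x' = T(x' | x)` and the channel kernel is
`O m m' = O(m' | m)`. -/

/-- Quantizers: maps from the source alphabet to the channel input alphabet. -/
def Quantizer (X M : Type*) := X → M

instance (X M : Type*) : MeasurableSpace (Quantizer X M) := ⊤

instance (X M : Type*) : DiscreteMeasurableSpace (Quantizer X M) := ⟨fun _ => trivial⟩

instance (X M : Type*) [Finite X] [Finite M] : Finite (Quantizer X M) :=
  inferInstanceAs (Finite (X → M))

section Belief

variable {X M M' Xhat : Type*} [Fintype X] [Fintype M'] [Fintype Xhat]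

/-- Probability `∑_x O_Q(m' | x) π(x)` of receiving `m'`, where `O_Q(m' | x) = O(m' | Q(x))`. -/
def outputProb (O : M → stdSimplex ℝ M') (π : stdSimplex ℝ X) (Q : Quantizer X M) (m' : M') : ℝ :=
  ∑ x, (O (Q x)).1 m' * π.1 x

theorem outputProb_nonneg (O : M → stdSimplex ℝ M') (π : stdSimplex ℝ X) (Q : Quantizer X M)
    (m' : M') : 0 ≤ outputProb O π Q m' :=
  Finset.sum_nonneg fun x _ => mul_nonneg ((O (Q x)).2.1 m') (π.2.1 x)

theorem sum_outputProb (O : M → stdSimplex ℝ M') (π : stdSimplex ℝ X) (Q : Quantizer X M) :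
    ∑ m', outputProb O π Q m' = 1 := by
  unfold outputProb
  rw [Finset.sum_comm]
  simp_rw [← Finset.sum_mul, (O _).2.2, one_mul]
  exact π.2.2

/-- The filter `x ↦ O_Q(m' | x) π(x) / ∑_x O_Q(m' | x) π(x)`; it is irrelevant (and set to `π`) when
`m'` has probability zero. -/
def beliefFilter (O : M → stdSimplex ℝ M') (π : stdSimplex ℝ X) (Q : Quantizer X M) (m' : M') :
    stdSimplex ℝ X :=
  ⟨fun x => if outputProb O π Q m' = 0 then π.1 x
    else (O (Q x)).1 m' * π.1 x / outputProb O π Q m', by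
    by_cases h : outputProb O π Q m' = 0
    · simp [h]
    · simp only [h, if_false]
      refine ⟨fun x => div_nonneg (mul_nonneg ((O (Q x)).2.1 m') (π.2.1 x))
        (outputProb_nonneg O π Q m'), ?_⟩
      rw [← Finset.sum_div]
      exact div_self h⟩

/-- The source kernel acting on beliefs: `(T μ)(x') = ∑_x T(x' | x) μ(x)`. -/
def propagate (T : X → stdSimplex ℝ X) (μ : stdSimplex ℝ X) : stdSimplex ℝ X :=
  ⟨fun x' => ∑ x, (T x).1 x' * μ.1 x, by
    refine ⟨fun x' => Finset.sum_nonneg fun x _ => mul_nonneg ((T x).2.1 x') (μ.2.1 x), ?_⟩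
    rw [Finset.sum_comm]
    simp_rw [← Finset.sum_mul, (T _).2.2, one_mul]
    exact μ.2.2⟩

/-- The predictor update `π_{t+1} = T(π̄_t)` from `π_t = π`, `Q_t = Q`, `M'_t = m'`. -/
def nextBelief (T : X → stdSimplex ℝ X) (O : M → stdSimplex ℝ M') (π : stdSimplex ℝ X)
    (Q : Quantizer X M) (m' : M') : stdSimplex ℝ X :=
  propagate T (beliefFilter O π Q m')

/-- `c(π, Q) = ∑_{m'} min_{x̂} ∑_x d(x, x̂) O_Q(m' | x) π(x)`. -/
def beliefCost [Nonempty Xhat] (O : M → stdSimplex ℝ M') (d : X → Xhat → ℝ≥0)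
    (π : stdSimplex ℝ X) (Q : Quantizer X M) : ℝ :=
  ∑ m', Finset.univ.inf' Finset.univ_nonempty fun xhat : Xhat =>
    ∑ x, (d x xhat : ℝ) * (O (Q x)).1 m' * π.1 x

theorem measurable_coord (x : X) : Measurable fun π : stdSimplex ℝ X => π.1 x :=
  (measurable_pi_apply x).comp measurable_subtype_coe

theorem measurable_outputProb (O : M → stdSimplex ℝ M') (Q : Quantizer X M) (m' : M') :
    Measurable fun π : stdSimplex ℝ X => outputProb O π Q m' :=
  Finset.measurable_fun_sum _ fun x _ => (measurable_coord x).const_mul _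

theorem measurable_nextBelief (T : X → stdSimplex ℝ X) (O : M → stdSimplex ℝ M')
    (Q : Quantizer X M) (m' : M') :
    Measurable fun π : stdSimplex ℝ X => nextBelief T O π Q m' := by
  refine Measurable.subtype_mk (measurable_pi_lambda _ fun x' => ?_)
  refine Finset.measurable_fun_sum _ fun x _ => Measurable.const_mul ?_ _
  exact Measurable.ite (measurable_outputProb O Q m' (measurableSet_singleton 0))
    (measurable_coord x) (((measurable_coord x).const_mul _).div (measurable_outputProb O Q m'))

theorem measurable_beliefCost [Nonempty Xhat] (O : M → stdSimplex ℝ M') (d : X → Xhat → ℝ≥0)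
    (Q : Quantizer X M) : Measurable fun π : stdSimplex ℝ X => beliefCost O d π Q := by
  refine Finset.measurable_fun_sum _ fun m' _ => ?_
  have h : Measurable (Finset.univ.inf' Finset.univ_nonempty
      fun (xhat : Xhat) (π : stdSimplex ℝ X) =>
        ∑ x, (d x xhat : ℝ) * (O (Q x)).1 m' * π.1 x) :=
    Finset.inf'_induction _ _ (fun _ hf _ hg => hf.inf hg) fun xhat _ =>
      Finset.measurable_fun_sum _ fun x _ => (measurable_coord x).const_mul _
  convert h using 1
  ext π
  simp [Finset.inf'_apply]

/-- `P(dπ' | π, Q)`: the law of the next predictor, i.e. of `nextBelief T O π Q M'` where `M'` takes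
the value `m'` with probability `outputProb O π Q m'`. -/
def beliefKernel [Finite M] (T : X → stdSimplex ℝ X) (O : M → stdSimplex ℝ M') :
    Kernel (stdSimplex ℝ X × Quantizer X M) (stdSimplex ℝ X) where
  toFun πQ := ∑ m' : M', ENNReal.ofReal (outputProb O πQ.1 πQ.2 m') •
    Measure.dirac (nextBelief T O πQ.1 πQ.2 m')
  measurable' := by
    refine measurable_from_prod_countable_left fun Q => ?_
    refine Measure.measurable_of_measurable_coe _ fun s hs => ?_
    simp only [Measure.coe_finsetSum, Finset.sum_apply, Measure.smul_apply, smul_eq_mul]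
    refine Finset.measurable_fun_sum _ fun m' _ => ?_
    exact (measurable_outputProb O Q m').ennreal_ofReal.mul
      ((Measure.measurable_coe hs).comp
        (Measure.measurable_dirac.comp (measurable_nextBelief T O Q m')))

/-- The belief MDP `(𝒫(𝒳), 𝒬, P, c)` of the zero-delay coding problem. -/
def beliefMDP [Finite M] [Nonempty Xhat] (T : X → stdSimplex ℝ X) (O : M → stdSimplex ℝ M')
    (d : X → Xhat → ℝ≥0) : MDP (stdSimplex ℝ X) (Quantizer X M) where
  P := beliefKernel T O
  markov := by
    refine ⟨fun πQ => ⟨?_⟩⟩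
    simp only [beliefKernel, Kernel.coe_mk, Measure.coe_finsetSum, Finset.sum_apply,
      Measure.smul_apply, measure_univ, smul_eq_mul, mul_one]
    rw [← ENNReal.ofReal_sum_of_nonneg fun m' _ => outputProb_nonneg O _ _ m', sum_outputProb,
      ENNReal.ofReal_one]
  cost πQ := beliefCost O d πQ.1 πQ.2
  cost_nonneg πQ := Finset.sum_nonneg fun m' _ => Finset.le_inf' _ _ fun xhat _ =>
    Finset.sum_nonneg fun x _ => mul_nonneg (mul_nonneg (d x xhat).2 ((O _).2.1 m')) (πQ.1.2.1 x)
  measurable_cost := measurable_from_prod_countable_left fun Q => measurable_beliefCost O d Q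

end Belief

/-! ### The grid `𝒫_N(𝒳)` and nearest-neighbor maps -/

section Grid

variable {X : Type*} [Fintype X]

/-- `𝒫_N(𝒳)`: beliefs of the form `(k_x / N)_x` with `k_x` natural numbers summing to `N`. -/
def Grid (X : Type*) [Fintype X] (N : ℕ+) : Type _ :=
  {π : stdSimplex ℝ X // ∃ k : X → ℕ, ∑ x, k x = N ∧ ∀ x, π.1 x = (k x : ℝ) / (N : ℝ)}

instance (N : ℕ+) : MeasurableSpace (Grid X N) := ⊤

instance (N : ℕ+) : DiscreteMeasurableSpace (Grid X N) := ⟨fun _ => trivial⟩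

instance (N : ℕ+) : Finite (Grid X N) := by
  classical
  have hle : ∀ k : X → ℕ, ∑ x, k x = (N : ℕ) → ∀ x, k x < (N : ℕ) + 1 := fun k hk x =>
    Nat.lt_succ_of_le (hk ▸ Finset.single_le_sum (fun _ _ => Nat.zero_le _) (Finset.mem_univ x))
  refine Finite.of_injective
    (fun p : Grid X N => fun x => (⟨p.2.choose x, hle _ p.2.choose_spec.1 x⟩ : Fin ((N : ℕ) + 1)))
    fun p p' h => Subtype.ext (Subtype.ext (funext fun x => ?_))
  have hx := congrArg Fin.val (congrFun h x)
  simp only at hx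
  rw [p.2.choose_spec.2 x, p'.2.choose_spec.2 x, hx]

instance (N : ℕ+) : Fintype (Grid X N) := Fintype.ofFinite _

/-- Euclidean distance between beliefs. -/
def beliefDist (π π' : stdSimplex ℝ X) : ℝ := Real.sqrt (∑ x, (π.1 x - π'.1 x) ^ 2)

/-- `q` maps every belief to a nearest neighbor in `𝒫_N(𝒳)` (ties broken in some way). -/
def IsNearestNeighbor {N : ℕ+} (q : stdSimplex ℝ X → Grid X N) : Prop :=
  ∀ (π : stdSimplex ℝ X) (p : Grid X N), beliefDist π (q π).1 ≤ beliefDist π p.1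

end Grid

/-! ### The zero-delay coding problem itself -/

section Coding

/-- Encoder policies: `M_t = γᵉ_t(X_{[0,t]}, M_{[0,t-1]}, M'_{[0,t-1]})`. -/
def Encoder (X M M' : Type*) := (t : ℕ) → (Fin (t + 1) → X) → (Fin t → M) → (Fin t → M') → M

/-- Decoder policies: `X̂_t = γᵈ_t(M'_{[0,t]})`. -/
def Decoder (M' Xhat : Type*) := (t : ℕ) → (Fin (t + 1) → M') → Xhat

variable {X M M' Xhat : Type*} [Fintype X] [Fintype M] [Fintype M'] [Fintype Xhat]

open Classical in
/-- The joint probability of `X_{[0,t]} = x`, `M_{[0,t]} = m`, `M'_{[0,t]} = m'` when `X_0 ∼ π₀` and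
the encoder `γ` is used. -/
def pathProb (T : X → stdSimplex ℝ X) (O : M → stdSimplex ℝ M') (π₀ : stdSimplex ℝ X)
    (γ : Encoder X M M') :
    (t : ℕ) → (Fin (t + 1) → X) → (Fin (t + 1) → M) → (Fin (t + 1) → M') → ℝ
  | 0, x, m, m' =>
      π₀.1 (x 0) * (if m 0 = γ 0 x Fin.elim0 Fin.elim0 then 1 else 0) * (O (m 0)).1 (m' 0)
  | t + 1, x, m, m' =>
      pathProb T O π₀ γ t (Fin.init x) (Fin.init m) (Fin.init m') *
        (T (x (Fin.last t).castSucc)).1 (x (Fin.last (t + 1))) *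
        (if m (Fin.last (t + 1)) = γ (t + 1) x (Fin.init m) (Fin.init m') then 1 else 0) *
        (O (m (Fin.last (t + 1)))).1 (m' (Fin.last (t + 1)))

/-- The expected distortion `E[d(X_t, X̂_t)]` at time `t`. -/
def expectedDistortion (T : X → stdSimplex ℝ X) (O : M → stdSimplex ℝ M') (d : X → Xhat → ℝ≥0)
    (π₀ : stdSimplex ℝ X) (γe : Encoder X M M') (γd : Decoder M' Xhat) (t : ℕ) : ℝ :=
  ∑ x : Fin (t + 1) → X, ∑ m : Fin (t + 1) → M, ∑ m' : Fin (t + 1) → M',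
    pathProb T O π₀ γe t x m m' * (d (x (Fin.last t)) (γd t m') : ℝ)

/-- The discounted distortion `E[∑_t β^t d(X_t, X̂_t)] = ∑_t β^t E[d(X_t, X̂_t)]` (all terms are
nonnegative), as an element of `[0, ∞]`. -/
def discountedDistortion (T : X → stdSimplex ℝ X) (O : M → stdSimplex ℝ M') (d : X → Xhat → ℝ≥0)
    (β : ℝ) (π₀ : stdSimplex ℝ X) (γe : Encoder X M M') (γd : Decoder M' Xhat) : ℝ≥0∞ :=
  ∑' t : ℕ, ENNReal.ofReal (β ^ t * expectedDistortion T O d π₀ γe γd t)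

/-- The discounted distortion of an encoder policy used with an optimal decoder policy. -/
def encoderDistortion (T : X → stdSimplex ℝ X) (O : M → stdSimplex ℝ M') (d : X → Xhat → ℝ≥0)
    (β : ℝ) (π₀ : stdSimplex ℝ X) (γe : Encoder X M M') : ℝ≥0∞ :=
  ⨅ γd : Decoder M' Xhat, discountedDistortion T O d β π₀ γe γd

/-- The optimal discounted distortion over all encoder and decoder policies. -/
def optimalDistortion (T : X → stdSimplex ℝ X) (O : M → stdSimplex ℝ M') (d : X → Xhat → ℝ≥0)
    (β : ℝ) (π₀ : stdSimplex ℝ X) : ℝ≥0∞ :=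
  ⨅ γe : Encoder X M M', encoderDistortion T O d β π₀ γe

/-- The predictor `π_t` as a function of `M'_{[0,t-1]}`, when `Q_s = g(π_s)` for all `s`. -/
def predictor (T : X → stdSimplex ℝ X) (O : M → stdSimplex ℝ M') (π₀ : stdSimplex ℝ X)
    (g : stdSimplex ℝ X → Quantizer X M) : (t : ℕ) → (Fin t → M') → stdSimplex ℝ X
  | 0, _ => π₀
  | t + 1, m' =>
      nextBelief T O (predictor T O π₀ g t (Fin.init m')) (g (predictor T O π₀ g t (Fin.init m')))
        (m' (Fin.last t))

/-- The stationary Walrand-Varaiya encoder policy given by `g`: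
`M_t = Q_t(X_t)` with `Q_t = g(π_t)`. -/
def walrandVaraiyaEncoder (T : X → stdSimplex ℝ X) (O : M → stdSimplex ℝ M') (π₀ : stdSimplex ℝ X)
    (g : stdSimplex ℝ X → Quantizer X M) : Encoder X M M' :=
  fun t x _ m' => g (predictor T O π₀ g t m') (x (Fin.last t))

end Coding

end

/-! Both optimal costs are compared with one number `W π₀`, where `W` solves the Bellman equation on
unnormalized beliefs, that is, vectors in `X → ℝ` that need not sum to one. The predictor update
divides by the probability of the received symbol, which may be arbitrarily small. For a positively
homogeneous `W` this division cancels (`IsRegularValue.outputProb_mul`), and only the linear maps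
`push` and `condMass` remain. They do not increase the total `ℓ¹` norm over all symbols, so value
iteration from zero stays Lipschitz with constant `D / (1 - β)`, and its limit `W` does too
(`exists_regular_bellman_fixedPoint`).

The bins of a nearest-neighbor map have `ℓ¹` diameter `O(1/N)`, so `W` and its state-action values
vary by `O(1/N)` on each bin. Sampled at bin representatives and shifted up or down by a constant of
that order, `W` becomes a super- or subsolution for the quantized MDP. An optimal policy there is
therefore almost greedy for `W` (`MDP.actionValue_optimal_quantize_le`), and its cost in the belief
MDP is at most `W π₀ + O(1/N)`.

For coding, `W` is superadditive as well. What an encoder knows beyond the received symbols acts as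
randomization of the quantizer, and superadditivity shows that randomization does not help
(`IsRegularValue.le_randomized`). Hence no code beats `W π₀`
(`IsRegularValue.le_discountedDistortion`), while the almost greedy encoder with a minimizing
decoder reaches `W π₀ + O(1/N)` (`IsRegularValue.encoderDistortion_le`). -/

noncomputable section

/-! ### Verification lemmas for discounted Markov decision processes. -/

namespace MDP

variable {Z U : Type*} [MeasurableSpace Z] [MeasurableSpace U]

instance (M : MDP Z U) (f : Policy Z U) (z₀ : Z) : IsProbabilityMeasure (M.processLaw f z₀) := by
  unfold processLaw; infer_instance

/-- The state-action value `c(z, u) + b ∫ w dP(· | z, u)` of a terminal value `w`. -/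
def actionValue (M : MDP Z U) (b : ℝ≥0∞) (w : Z → ℝ≥0∞) (zu : Z × U) : ℝ≥0∞ :=
  ENNReal.ofReal (M.cost zu) + b * ∫⁻ z, w z ∂M.P zu

theorem measurable_actionValue (M : MDP Z U) (b : ℝ≥0∞) {w : Z → ℝ≥0∞} (hw : Measurable w) :
    Measurable (M.actionValue b w) :=
  M.measurable_cost.ennreal_ofReal.add (hw.lintegral_kernel.const_mul b)

theorem lintegral_processLaw_zero (M : MDP Z U) (f : Policy Z U) (z₀ : Z) {F : Z × U → ℝ≥0∞}
    (hF : Measurable F) :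
    ∫⁻ ω, F (ω 0) ∂M.processLaw f z₀ = F (z₀, f.act 0 (fun _ => z₀, Fin.elim0)) := by
  unfold processLaw Kernel.trajMeasure
  have hF0 : Measurable fun ω : ℕ → Z × U => F (ω 0) := hF.comp (measurable_pi_apply 0)
  rw [Measure.lintegral_bind (Kernel.aemeasurable _) hF0.aemeasurable]
  have hF' : ∀ x : (_ : Finset.Iic 0) → Z × U,
      ∫⁻ ω : ℕ → Z × U, F (ω 0) ∂(Kernel.traj (X := fun _ => Z × U) (M.stepKernel f) 0 x)
      = F (x ⟨0, by simp⟩) := by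
    intro x
    have h := Kernel.traj_map_frestrictLe_apply (X := fun _ => Z × U) (κ := M.stepKernel f) 0 0 x
    rw [Kernel.partialTraj_self, Kernel.id_apply] at h
    have hG : Measurable fun y : (_ : Finset.Iic 0) → Z × U => F (y ⟨0, by simp⟩) := by fun_prop
    have h2 := lintegral_map (μ := Kernel.traj (M.stepKernel f) 0 x) hG
      (Preorder.measurable_frestrictLe (X := fun _ => Z × U) 0)
    rw [h, lintegral_dirac' _ hG] at h2
    exact h2.symm
  simp_rw [hF']
  rw [lintegral_map (by fun_prop) (by fun_prop), lintegral_dirac' _ (by fun_prop)]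
  rfl

/-- The history law up to `t`, composed with the step kernel, is the law of the history together
with the next coordinate; the step kernel in turn draws a state from `P` and appends a deterministic
action. -/
theorem lintegral_processLaw_succ (M : MDP Z U) (f : Policy Z U) (z₀ : Z) (t : ℕ)
    {F : Z × U → ℝ≥0∞} (hF : Measurable F) :
    ∫⁻ ω, F (ω (t + 1)) ∂M.processLaw f z₀ =
      ∫⁻ ω, ∫⁻ z, F (extendHistory f t (Preorder.frestrictLe t ω, z)) ∂M.P (ω t)
        ∂M.processLaw f z₀ := by
  have := M.markov
  have h := Kernel.map_frestrictLe_trajMeasure_compProd_eq_map_trajMeasure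
    (X := fun _ => Z × U)
    (μ₀ := Measure.dirac (z₀, f.act 0 (fun _ => z₀, Fin.elim0))) (κ := M.stepKernel f) (a := t)
  have hG : Measurable fun p : ((_ : Finset.Iic t) → Z × U) × (Z × U) => F p.2 := by fun_prop
  have h1 := congrArg (fun m => ∫⁻ p, F p.2 ∂m) h
  rw [lintegral_map hG (by fun_prop), Measure.lintegral_compProd hG,
    lintegral_map (hG.lintegral_kernel_prod_right') (by fun_prop)] at h1
  refine h1.symm.trans (lintegral_congr fun ω => ?_)
  have hFe : Measurable fun p => F (extendHistory f t p) :=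
    hF.comp (measurable_extendHistory f t)
  rw [stepKernel, Kernel.map_apply _ (measurable_extendHistory f t),
    lintegral_map hF (measurable_extendHistory f t), Kernel.prod_apply, Kernel.id_apply,
    Kernel.comap_apply,
    lintegral_prod _ hFe.aemeasurable,
    lintegral_dirac']
  · rfl
  · exact hFe.lintegral_prod_right'

theorem discountedCost_eq_tsum (M : MDP Z U) {β : ℝ} (hβ : 0 ≤ β) (z₀ : Z) (f : Policy Z U) :
    M.discountedCost β z₀ f = ∑' t : ℕ, ENNReal.ofReal β ^ t *
      ∫⁻ ω, ENNReal.ofReal (M.cost (ω t)) ∂M.processLaw f z₀ := by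
  have hm : ∀ t : ℕ, Measurable fun ω : ℕ → Z × U => M.cost (ω t) := fun t =>
    M.measurable_cost.comp (measurable_pi_apply t)
  unfold discountedCost
  rw [lintegral_tsum fun t => ((hm t).const_mul _).ennreal_ofReal.aemeasurable]
  refine tsum_congr fun t => ?_
  rw [← lintegral_const_mul _ (hm t).ennreal_ofReal]
  refine lintegral_congr fun ω => ?_
  rw [ENNReal.ofReal_mul (pow_nonneg hβ t), ENNReal.ofReal_pow hβ]

/-- Expected value of `w` at the state following time `t`. -/
def expectedNext (M : MDP Z U) (f : Policy Z U) (z₀ : Z) (w : Z → ℝ≥0∞) (t : ℕ) : ℝ≥0∞ :=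
  ∫⁻ ω, ∫⁻ z, w z ∂M.P (ω t) ∂M.processLaw f z₀

theorem lintegral_actionValue (M : MDP Z U) (f : Policy Z U) (z₀ : Z) (b : ℝ≥0∞)
    {w : Z → ℝ≥0∞} (hw : Measurable w) (t : ℕ) :
    ∫⁻ ω, M.actionValue b w (ω t) ∂M.processLaw f z₀ =
      ∫⁻ ω, ENNReal.ofReal (M.cost (ω t)) ∂M.processLaw f z₀ + b * M.expectedNext f z₀ w t := by
  have h1 : Measurable fun ω : ℕ → Z × U => ENNReal.ofReal (M.cost (ω t)) :=
    (M.measurable_cost.comp (measurable_pi_apply t)).ennreal_ofReal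
  have h2 : Measurable fun ω : ℕ → Z × U => ∫⁻ z, w z ∂M.P (ω t) :=
    hw.lintegral_kernel.comp (measurable_pi_apply t)
  unfold actionValue expectedNext
  rw [lintegral_add_left h1, lintegral_const_mul _ h2]

/-- Verification lemma, lower bound: a bounded subsolution of the Bellman equation bounds the cost
of every policy from below. -/
theorem actionValue_le_discountedCost (M : MDP Z U) {β : ℝ} (hβ0 : 0 ≤ β) (hβ1 : β < 1)
    {w : Z → ℝ≥0∞} (hw : Measurable w) {C : ℝ≥0∞} (hC : C ≠ ∞) (hwC : ∀ z, w z ≤ C)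
    (hsub : ∀ zu, w zu.1 ≤ M.actionValue (ENNReal.ofReal β) w zu) (f : Policy Z U) (z₀ : Z) :
    M.actionValue (ENNReal.ofReal β) w (z₀, f.act 0 (fun _ => z₀, Fin.elim0)) ≤
      M.discountedCost β z₀ f := by
  have := M.markov
  set b := ENNReal.ofReal β
  have hb : b < 1 := by simpa [b] using hβ1
  set a : ℕ → ℝ≥0∞ := fun t => ∫⁻ ω, ENNReal.ofReal (M.cost (ω t)) ∂M.processLaw f z₀ with ha
  have hstep : ∀ t, M.expectedNext f z₀ w t ≤ a (t + 1) + b * M.expectedNext f z₀ w (t + 1) := by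
    intro t
    rw [← lintegral_actionValue M f z₀ b hw, lintegral_processLaw_succ M f z₀ t
      (M.measurable_actionValue b hw)]
    exact lintegral_mono fun ω => lintegral_mono fun z => hsub (extendHistory f t (_, z))
  -- The left side keeps the value of the first action instead of weakening it to `w z₀`. Applied to
  -- an optimal policy, this shows that the action it picks is almost greedy.
  have hpartial : ∀ n, M.actionValue b w (z₀, f.act 0 (fun _ => z₀, Fin.elim0)) ≤
      ∑ t ∈ Finset.range (n + 1), b ^ t * a t + b ^ (n + 1) * M.expectedNext f z₀ w n := by
    intro n
    induction n with
    | zero =>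
      rw [← lintegral_processLaw_zero M f z₀ (M.measurable_actionValue b hw),
        lintegral_actionValue M f z₀ b hw]
      simp [ha]
    | succ n ih =>
      refine ih.trans ?_
      rw [Finset.sum_range_succ _ (n + 1), add_assoc]
      gcongr
      calc b ^ (n + 1) * M.expectedNext f z₀ w n
          ≤ b ^ (n + 1) * (a (n + 1) + b * M.expectedNext f z₀ w (n + 1)) := by
            gcongr; exact hstep n
        _ = _ := by ring
  have hbound : ∀ n, M.expectedNext f z₀ w n ≤ C := by
    intro n
    calc M.expectedNext f z₀ w n ≤ ∫⁻ ω, ∫⁻ z, C ∂M.P (ω n) ∂M.processLaw f z₀ :=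
          lintegral_mono fun ω => lintegral_mono fun z => hwC z
      _ = C := by simp
  -- The boundedness of `w` is what makes the discounted tail vanish.
  have hlim : Tendsto (fun n : ℕ => M.discountedCost β z₀ f + b ^ (n + 1) * C) atTop
      (𝓝 (M.discountedCost β z₀ f + 0 * C)) :=
    tendsto_const_nhds.add (ENNReal.Tendsto.mul_const
      ((ENNReal.tendsto_pow_atTop_nhds_zero_of_lt_one hb).comp (tendsto_add_atTop_nat 1))
      (Or.inr hC))
  rw [zero_mul, add_zero] at hlim
  refine ge_of_tendsto' hlim fun n => (hpartial n).trans ?_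
  rw [discountedCost_eq_tsum M hβ0]
  exact add_le_add (ENNReal.sum_le_tsum _) (by gcongr; exact hbound n)

/-- Verification lemma, upper bound: a supersolution of the Bellman equation of a stationary policy
bounds its cost from above. -/
theorem discountedCost_stationary_le (M : MDP Z U) {β : ℝ} (hβ0 : 0 ≤ β)
    {w : Z → ℝ≥0∞} (hw : Measurable w) {g : Z → U} (hg : Measurable g)
    (hsup : ∀ z, M.actionValue (ENNReal.ofReal β) w (z, g z) ≤ w z) (z₀ : Z) :
    M.discountedCost β z₀ (Policy.stationary g hg) ≤ w z₀ := by
  set b := ENNReal.ofReal β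
  set f := Policy.stationary g hg with hf
  set a : ℕ → ℝ≥0∞ := fun t => ∫⁻ ω, ENNReal.ofReal (M.cost (ω t)) ∂M.processLaw f z₀ with ha
  have hstep : ∀ t, a (t + 1) + b * M.expectedNext f z₀ w (t + 1) ≤ M.expectedNext f z₀ w t := by
    intro t
    rw [← lintegral_actionValue M f z₀ b hw, lintegral_processLaw_succ M f z₀ t
      (M.measurable_actionValue b hw)]
    refine lintegral_mono fun ω => lintegral_mono fun z => ?_
    have : extendHistory f t (Preorder.frestrictLe t ω, z) = (z, g z) := by
      simp [extendHistory, hf, Policy.stationary]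
    rw [this]
    exact hsup z
  -- Here the tail is nonnegative and can simply be dropped, so `w` needs no bound.
  have hpartial : ∀ n, ∑ t ∈ Finset.range (n + 1), b ^ t * a t +
      b ^ (n + 1) * M.expectedNext f z₀ w n ≤ w z₀ := by
    intro n
    induction n with
    | zero =>
      refine le_trans (le_of_eq ?_) (hsup z₀)
      have h := lintegral_processLaw_zero M f z₀ (M.measurable_actionValue b hw)
      rw [lintegral_actionValue M f z₀ b hw] at h
      simpa [ha, hf, Policy.stationary] using h
    | succ n ih =>
      refine le_trans ?_ ih
      rw [Finset.sum_range_succ _ (n + 1), add_assoc]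
      gcongr
      calc b ^ (n + 1) * a (n + 1) + b ^ (n + 1 + 1) * M.expectedNext f z₀ w (n + 1)
          = b ^ (n + 1) * (a (n + 1) + b * M.expectedNext f z₀ w (n + 1)) := by ring
        _ ≤ _ := by gcongr; exact hstep n
  rw [discountedCost_eq_tsum M hβ0, ENNReal.tsum_eq_iSup_nat]
  refine iSup_le fun n => le_trans ?_ (hpartial n)
  rw [Finset.sum_range_succ]
  exact le_add_right le_self_add

end MDP

/-! ### Near-greediness of optimal policies of a quantized MDP. -/

namespace MDP

variable {Z U : Type*} [MeasurableSpace Z] [MeasurableSpace U]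

/-- The kernel has mass one, so a constant error in the terminal value is only discounted. -/
theorem actionValue_le_add (M : MDP Z U) (b : ℝ≥0∞) {w w' : Z → ℝ≥0∞} (k : ℝ≥0∞)
    (h : ∀ z, w z ≤ w' z + k) (zu : Z × U) :
    M.actionValue b w zu ≤ M.actionValue b w' zu + b * k := by
  have := M.markov
  unfold actionValue
  rw [add_assoc, ← mul_add]
  gcongr
  calc ∫⁻ z, w z ∂M.P zu ≤ ∫⁻ z, (w' z + k) ∂M.P zu := lintegral_mono h
    _ = ∫⁻ z, w' z ∂M.P zu + k := by rw [lintegral_add_right _ measurable_const]; simp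

theorem ae_cond_fiber {G : Type*} [MeasurableSpace G] [MeasurableSingletonClass G] {q : Z → G}
    (hq : Measurable q) (ν : Measure Z) (i : G) : ∀ᵐ z ∂(ν[|q ⁻¹' {i}]), q z = i := by
  have := ae_cond_mem (μ := ν) (hq (measurableSet_singleton i))
  simpa using this

section Quantize

variable {G : Type*} [Fintype G] [MeasurableSpace G] [MeasurableSingletonClass G]
    [Countable U] [MeasurableSingletonClass U] (M : MDP Z U)
    {q : Z → G} (hq : Measurable q) (ν : Measure Z) [IsProbabilityMeasure ν]
    (hν : ∀ i, 0 < ν (q ⁻¹' {i}))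

/-- One step of the quantized MDP amounts to drawing a state from the bin, moving with the original
kernel and quantizing the result. -/
theorem lintegral_quantize (F : G → ℝ≥0∞) (iu : G × U) :
    ∫⁻ j, F j ∂(M.quantize q hq ν hν).P iu =
      ∫⁻ z, ∫⁻ z', F (q z') ∂M.P (z, iu.2) ∂(ν[|q ⁻¹' {iu.1}]) := by
  have hF : Measurable F := Measurable.of_discrete
  have hmeas : ∀ j : G, Measurable fun z => M.P (z, iu.2) (q ⁻¹' {j}) := fun j =>
    (M.P.measurable_coe (hq (measurableSet_singleton j))).comp
      (measurable_id.prodMk measurable_const)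
  have h : ∀ z, ∫⁻ z', F (q z') ∂M.P (z, iu.2) = ∑ j, F j * M.P (z, iu.2) (q ⁻¹' {j}) := by
    intro z
    rw [← lintegral_map hF hq, lintegral_fintype]
    exact Finset.sum_congr rfl fun j _ => by rw [Measure.map_apply hq (measurableSet_singleton j)]
  simp_rw [h]
  rw [lintegral_finsetSum _ fun j _ => (hmeas j).const_mul _]
  simp only [quantize, Kernel.coe_mk, lintegral_finsetSum_measure, lintegral_smul_measure,
    lintegral_dirac, smul_eq_mul]
  refine Finset.sum_congr rfl fun j _ => ?_
  rw [lintegral_const_mul _ (hmeas j), mul_comm]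

/-- Quantized state-action values are bin averages of original ones, so bounds valid throughout a
bin carry over. The bound on the cost makes the Bochner integral defining the quantized cost agree
with a Lebesgue integral. -/
theorem actionValue_quantize {D : ℝ} (hD : ∀ zu, M.cost zu ≤ D) (b : ℝ≥0∞) (w : G → ℝ≥0∞)
    (i : G) (u : U) :
    (M.quantize q hq ν hν).actionValue b w (i, u) =
      ∫⁻ z, M.actionValue b (fun z => w (q z)) (z, u) ∂(ν[|q ⁻¹' {i}]) := by
  have := cond_isProbabilityMeasure (hν i).ne'
  have hw : Measurable fun z => w (q z) := Measurable.of_discrete.comp hq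
  have hc : Measurable fun z => M.cost (z, u) :=
    M.measurable_cost.comp (measurable_id.prodMk measurable_const)
  have hP : Measurable fun z => ∫⁻ z', w (q z') ∂M.P (z, u) :=
    hw.lintegral_kernel.comp (measurable_id.prodMk measurable_const)
  have hint : Integrable (fun z => M.cost (z, u)) (ν[|q ⁻¹' {i}]) :=
    Integrable.of_bound hc.aestronglyMeasurable D (ae_of_all _ fun z => by
      rw [Real.norm_of_nonneg (M.cost_nonneg _)]; exact hD _)
  unfold actionValue
  rw [lintegral_add_left hc.ennreal_ofReal, lintegral_const_mul _ hP, lintegral_quantize,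
    ← ofReal_integral_eq_lintegral_ofReal hint (ae_of_all _ fun z => M.cost_nonneg _)]
  rfl

/-- Suppose that `V` solves the Bellman equation of `M`, and that `V` and its state-action values
vary by at most `ε` in every bin. Then an optimal policy of the quantized MDP is almost greedy with
respect to `V`. -/
theorem actionValue_optimal_quantize_le {β : ℝ} (hβ0 : 0 ≤ β) (hβ1 : β < 1)
    {D : ℝ} (hD : ∀ zu, M.cost zu ≤ D)
    {V : Z → ℝ≥0∞} {C : ℝ≥0∞} (hC : C ≠ ∞) (hVC : ∀ z, V z ≤ C)
    (hsub : ∀ zu, V zu.1 ≤ M.actionValue (ENNReal.ofReal β) V zu)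
    (hatt : ∀ z, ∃ u, M.actionValue (ENNReal.ofReal β) V (z, u) ≤ V z)
    {ε a : ℝ≥0∞} (ha : 2 * ε + ENNReal.ofReal β * a ≤ a)
    (hVq : ∀ z z', q z = q z' → V z ≤ V z' + ε)
    (hQq : ∀ z z' u, q z = q z' → M.actionValue (ENNReal.ofReal β) V (z, u) ≤
      M.actionValue (ENNReal.ofReal β) V (z', u) + ε)
    {γ : G → U} (hγ : (M.quantize q hq ν hν).IsOptimal β
      (Policy.stationary γ Measurable.of_discrete)) (z : Z) :
    M.actionValue (ENNReal.ofReal β) V (z, γ (q z)) ≤ V z + 3 * a := by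
  set b := ENNReal.ofReal β
  have hb : b ≤ 1 := by simpa [b] using hβ1.le
  have hne : ∀ i, ∃ z, q z = i := by
    intro i
    obtain ⟨z, hz⟩ := nonempty_of_measure_ne_zero (hν i).ne'
    exact ⟨z, hz⟩
  -- `r i` is a representative of bin `i`, and `s` is a greedy selector for `V`.
  choose r hr using hne
  choose s hs using hatt
  have hprob : ∀ i, IsProbabilityMeasure (ν[|q ⁻¹' {i}]) := fun i =>
    cond_isProbabilityMeasure (hν i).ne'
  have hba : ε + b * (ε + a) ≤ a := by
    refine le_trans ?_ ha
    rw [two_mul, mul_add, ← add_assoc]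
    gcongr
    exact mul_le_of_le_one_left' hb
  -- `V ∘ r + a` is a supersolution for the policy `s ∘ r`: one `ε` moves the state within its bin,
  -- and a discounted `ε` moves the next state.
  have hup : ∀ i, (M.quantize q hq ν hν).actionValue b (fun i => V (r i) + a) (i, s (r i)) ≤
      V (r i) + a := by
    intro i
    rw [actionValue_quantize M hq ν hν hD]
    have h : ∀ᵐ z ∂(ν[|q ⁻¹' {i}]),
        M.actionValue b (fun z => V (r (q z)) + a) (z, s (r i)) ≤ V (r i) + a := by
      filter_upwards [ae_cond_fiber hq ν i] with z hz
      have h1 : ∀ z', V (r (q z')) + a ≤ V z' + (ε + a) := fun z' => by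
        rw [← add_assoc]; gcongr; exact hVq _ _ (hr _)
      calc _ ≤ M.actionValue b V (z, s (r i)) + b * (ε + a) := M.actionValue_le_add b _ h1 _
        _ ≤ (M.actionValue b V (r i, s (r i)) + ε) + b * (ε + a) := by
          gcongr; exact hQq _ _ _ (by rw [hz, hr])
        _ ≤ V (r i) + (ε + b * (ε + a)) := by rw [← add_assoc]; gcongr; exact hs _
        _ ≤ _ := by gcongr
    calc _ ≤ ∫⁻ _, V (r i) + a ∂(ν[|q ⁻¹' {i}]) := lintegral_mono_ae h
      _ = _ := by simp
  -- The mirror estimate makes `V ∘ r - a` a subsolution. Subtraction in `ℝ≥0∞` is truncated, which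
  -- is harmless because only `x ≤ (x - a) + a` is used.
  have hlow : ∀ i u, M.actionValue b V (r i, u) ≤
      (M.quantize q hq ν hν).actionValue b (fun i => V (r i) - a) (i, u) + a := by
    intro i u
    rw [actionValue_quantize M hq ν hν hD, ← tsub_le_iff_right]
    have h : ∀ᵐ z ∂(ν[|q ⁻¹' {i}]), M.actionValue b V (r i, u) - a ≤
        M.actionValue b (fun z => V (r (q z)) - a) (z, u) := by
      filter_upwards [ae_cond_fiber hq ν i] with z hz
      rw [tsub_le_iff_right]
      have h1 : ∀ z', V z' ≤ (V (r (q z')) - a) + (ε + a) := fun z' => by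
        calc V z' ≤ V (r (q z')) + ε := hVq _ _ (hr _).symm
          _ ≤ ((V (r (q z')) - a) + a) + ε := by gcongr; exact le_tsub_add
          _ = _ := by ring
      calc M.actionValue b V (r i, u) ≤ M.actionValue b V (z, u) + ε :=
            hQq _ _ _ (by rw [hz, hr])
        _ ≤ (M.actionValue b (fun z => V (r (q z)) - a) (z, u) + b * (ε + a)) + ε := by
          gcongr; exact M.actionValue_le_add b _ h1 _
        _ = M.actionValue b (fun z => V (r (q z)) - a) (z, u) + (ε + b * (ε + a)) := by ring
        _ ≤ _ := by gcongr
    calc _ = ∫⁻ _, (M.actionValue b V (r i, u) - a) ∂(ν[|q ⁻¹' {i}]) := by simp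
      _ ≤ _ := lintegral_mono_ae h
  -- The value of the action `γ i` is at most the cost of the optimal policy, which is at most that
  -- of `s ∘ r`.
  have hJ : ∀ i, (M.quantize q hq ν hν).actionValue b (fun i => V (r i) - a) (i, γ i) ≤
      V (r i) + a := by
    intro i
    have h1 := actionValue_le_discountedCost (M.quantize q hq ν hν) hβ0 hβ1
      (w := fun i => V (r i) - a) Measurable.of_discrete hC (fun i => tsub_le_self.trans (hVC _))
      (fun iu => tsub_le_iff_right.2 ((hsub (r iu.1, iu.2)).trans (hlow iu.1 iu.2)))
      (Policy.stationary γ Measurable.of_discrete) i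
    refine h1.trans ((hγ i).le.trans ((iInf_le _ _).trans
      (discountedCost_stationary_le (M.quantize q hq ν hν) hβ0
        (w := fun i => V (r i) + a) Measurable.of_discrete
        (g := fun i => s (r i)) Measurable.of_discrete hup i)))
  have hεa : 2 * ε ≤ a := le_self_add.trans ha
  -- Passing from `z` to its representative and back costs `2 * ε ≤ a`, hence the total `3 * a`.
  calc M.actionValue b V (z, γ (q z)) ≤ M.actionValue b V (r (q z), γ (q z)) + ε :=
        hQq _ _ _ (hr _).symm
    _ ≤ ((V (r (q z)) + a) + a) + ε := by
        gcongr; exact (hlow _ _).trans (by gcongr; exact hJ _)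
    _ ≤ (((V z + ε) + a) + a) + ε := by gcongr; exact hVq _ _ (hr _)
    _ = V z + 2 * a + 2 * ε := by ring
    _ ≤ V z + 2 * a + a := by gcongr
    _ = _ := by ring

end Quantize

/-- Performance bound for a stationary policy that is greedy up to `k` for a supersolution `V`. -/
theorem discountedCost_stationary_le_add (M : MDP Z U) {β : ℝ} (hβ0 : 0 ≤ β)
    {V : Z → ℝ≥0∞} (hV : Measurable V) {g : Z → U} (hg : Measurable g) {k A : ℝ≥0∞}
    (hA : k + ENNReal.ofReal β * A ≤ A)
    (h : ∀ z, M.actionValue (ENNReal.ofReal β) V (z, g z) ≤ V z + k) (z₀ : Z) :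
    M.discountedCost β z₀ (Policy.stationary g hg) ≤ V z₀ + A := by
  refine discountedCost_stationary_le M hβ0 (w := fun z => V z + A) (hV.add_const A) hg
    (fun z => ?_) z₀
  calc _ ≤ M.actionValue (ENNReal.ofReal β) V (z, g z) + ENNReal.ofReal β * A :=
        M.actionValue_le_add _ A (fun _ => le_rfl) _
    _ ≤ (V z + k) + ENNReal.ofReal β * A := by gcongr; exact h z
    _ ≤ V z + A := by rw [add_assoc]; gcongr

end MDP

/-! ### Minima of finite families. -/

section FinsetInf

variable {ι : Type*} {s : Finset ι} (hs : s.Nonempty)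

theorem inf'_le_inf'_add_of_le {f g : ι → ℝ} {c : ℝ} (h : ∀ i ∈ s, f i ≤ g i + c) :
    s.inf' hs f ≤ s.inf' hs g + c := by
  obtain ⟨i, hi, hgi⟩ := s.exists_mem_eq_inf' hs g
  rw [hgi]
  exact (s.inf'_le f hi).trans (h i hi)

theorem abs_inf'_sub_inf'_le {f g : ι → ℝ} {c : ℝ} (h : ∀ i ∈ s, |f i - g i| ≤ c) :
    |s.inf' hs f - s.inf' hs g| ≤ c := by
  refine abs_sub_le_iff.2 ⟨?_, ?_⟩
  · have := inf'_le_inf'_add_of_le hs (f := f) (g := g) (c := c) fun i hi => by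
      linarith [(abs_sub_le_iff.1 (h i hi)).1]
    linarith
  · have := inf'_le_inf'_add_of_le hs (f := g) (g := f) (c := c) fun i hi => by
      linarith [(abs_sub_le_iff.1 (h i hi)).2]
    linarith

theorem inf'_add_inf'_le (f g : ι → ℝ) :
    s.inf' hs f + s.inf' hs g ≤ s.inf' hs fun i => f i + g i :=
  Finset.le_inf' _ _ fun _ hi => add_le_add (Finset.inf'_le f hi) (Finset.inf'_le g hi)

theorem inf'_const_mul {r : ℝ} (hr : 0 ≤ r) (f : ι → ℝ) :
    (s.inf' hs fun i => r * f i) = r * s.inf' hs f :=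
  (Finset.apply_inf'_eq_inf'_comp hs (fun x => r * x) fun x y => mul_min_of_nonneg x y hr).symm

end FinsetInf

/-! ### The Bellman equation on unnormalized beliefs -/

section Unnormalized

variable {X M M' Xhat : Type*} [Fintype X] [Fintype M'] [Fintype Xhat]

/-- The `ℓ¹` norm of a vector indexed by a finite alphabet. -/
def ell1 (μ : X → ℝ) : ℝ := ∑ x, |μ x|

theorem ell1_nonneg (μ : X → ℝ) : 0 ≤ ell1 μ := Finset.sum_nonneg fun _ _ => abs_nonneg _

theorem ell1_coe (π : stdSimplex ℝ X) : ell1 π.1 = 1 :=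
  (Finset.sum_congr rfl fun x _ => abs_of_nonneg (π.2.1 x)).trans π.2.2

/-- The source kernel acting linearly on vectors: `x' ↦ ∑_x T(x' | x) μ(x)`. -/
def push (T : X → stdSimplex ℝ X) : (X → ℝ) →ₗ[ℝ] (X → ℝ) where
  toFun μ x' := ∑ x, (T x).1 x' * μ x
  map_add' μ ν := by ext; simp [mul_add, Finset.sum_add_distrib]
  map_smul' r μ := by ext; simp [Finset.mul_sum, mul_left_comm]

/-- The unnormalized filter `x ↦ O_Q(y | x) μ(x)`. -/
def condMass (O : M → stdSimplex ℝ M') (Q : Quantizer X M) (y : M') :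
    (X → ℝ) →ₗ[ℝ] (X → ℝ) where
  toFun μ x := (O (Q x)).1 y * μ x
  map_add' μ ν := by ext; simp [mul_add]
  map_smul' r μ := by ext; simp [mul_left_comm]

omit [Fintype X] in
theorem condMass_apply (O : M → stdSimplex ℝ M') (Q : Quantizer X M) (y : M') (μ : X → ℝ) (x : X) :
    condMass O Q y μ x = (O (Q x)).1 y * μ x := rfl

theorem push_apply (T : X → stdSimplex ℝ X) (μ : X → ℝ) (x' : X) :
    push T μ x' = ∑ x, (T x).1 x' * μ x := rfl

theorem push_nonneg (T : X → stdSimplex ℝ X) {μ : X → ℝ} (hμ : 0 ≤ μ) : 0 ≤ push T μ :=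
  fun x' => Finset.sum_nonneg fun x _ => mul_nonneg ((T x).2.1 x') (hμ x)

omit [Fintype X] in
theorem condMass_nonneg (O : M → stdSimplex ℝ M') (Q : Quantizer X M) (y : M') {μ : X → ℝ}
    (hμ : 0 ≤ μ) : 0 ≤ condMass O Q y μ :=
  fun x => mul_nonneg ((O (Q x)).2.1 y) (hμ x)

theorem sum_push (T : X → stdSimplex ℝ X) (μ : X → ℝ) : ∑ x', push T μ x' = ∑ x, μ x := by
  simp only [push_apply]
  rw [Finset.sum_comm]
  simp_rw [← Finset.sum_mul, (T _).2.2, one_mul]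

omit [Fintype X] in
theorem sum_condMass (O : M → stdSimplex ℝ M') (Q : Quantizer X M) (μ : X → ℝ) (x : X) :
    ∑ y, condMass O Q y μ x = μ x := by
  simp_rw [condMass_apply, ← Finset.sum_mul, (O _).2.2, one_mul]

theorem ell1_push_le (T : X → stdSimplex ℝ X) (μ : X → ℝ) : ell1 (push T μ) ≤ ell1 μ := by
  calc ell1 (push T μ) ≤ ∑ x', ∑ x, (T x).1 x' * |μ x| := by
        refine Finset.sum_le_sum fun x' _ => (Finset.abs_sum_le_sum_abs _ _).trans
          (Finset.sum_le_sum fun x _ => ?_)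
        rw [abs_mul, abs_of_nonneg ((T x).2.1 x')]
    _ = ell1 μ := sum_push T fun x => |μ x|

theorem sum_ell1_condMass (O : M → stdSimplex ℝ M') (Q : Quantizer X M) (μ : X → ℝ) :
    ∑ y, ell1 (condMass O Q y μ) = ell1 μ := by
  unfold ell1
  rw [Finset.sum_comm]
  refine Finset.sum_congr rfl fun x _ => ?_
  rw [← sum_condMass O Q (fun x => |μ x|) x]
  refine Finset.sum_congr rfl fun y _ => ?_
  rw [condMass_apply, condMass_apply, abs_mul, abs_of_nonneg ((O (Q x)).2.1 y)]

/-- The channel splits absolute mass exactly and the source kernel does not increase it. This lets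
Lipschitz constants pass through a Bellman step without any lower bound on symbol probabilities. -/
theorem sum_ell1_push_condMass_le (T : X → stdSimplex ℝ X) (O : M → stdSimplex ℝ M')
    (Q : Quantizer X M) (μ : X → ℝ) : ∑ y, ell1 (push T (condMass O Q y μ)) ≤ ell1 μ :=
  (Finset.sum_le_sum fun _ _ => ell1_push_le T _).trans (sum_ell1_condMass O Q μ).le

variable [Nonempty Xhat]

/-- The smallest distortion `min_{x̂} ∑_x d(x, x̂) μ(x)` achievable under the belief `μ`. -/
def minDistortion (d : X → Xhat → ℝ≥0) (μ : X → ℝ) : ℝ :=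
  Finset.univ.inf' Finset.univ_nonempty fun xhat : Xhat => ∑ x, (d x xhat : ℝ) * μ x

omit [Nonempty Xhat] in
theorem exists_distortion_bound (d : X → Xhat → ℝ≥0) :
    ∃ D : ℝ, 0 ≤ D ∧ ∀ x xhat, (d x xhat : ℝ) ≤ D :=
  ⟨∑ x, ∑ xhat, (d x xhat : ℝ),
    Finset.sum_nonneg fun _ _ => Finset.sum_nonneg fun _ _ => NNReal.coe_nonneg _,
    fun x xhat => (Finset.single_le_sum (f := fun xhat => (d x xhat : ℝ))
      (fun _ _ => NNReal.coe_nonneg _) (Finset.mem_univ xhat)).trans (Finset.single_le_sum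
        (f := fun x => ∑ xhat, (d x xhat : ℝ))
        (fun _ _ => Finset.sum_nonneg fun _ _ => NNReal.coe_nonneg _) (Finset.mem_univ x))⟩

/-- One reproduction letter for the merged masses cannot beat separate choices for each. -/
theorem minDistortion_add_le (d : X → Xhat → ℝ≥0) (μ ν : X → ℝ) :
    minDistortion d μ + minDistortion d ν ≤ minDistortion d (μ + ν) := by
  refine (inf'_add_inf'_le _ _ _).trans (le_of_eq ?_)
  simp [minDistortion, mul_add, Finset.sum_add_distrib]

theorem minDistortion_smul (d : X → Xhat → ℝ≥0) {r : ℝ} (hr : 0 ≤ r) (μ : X → ℝ) :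
    minDistortion d (r • μ) = r * minDistortion d μ := by
  unfold minDistortion
  rw [← inf'_const_mul _ hr]
  simp [Finset.mul_sum, mul_left_comm]

theorem minDistortion_nonneg (d : X → Xhat → ℝ≥0) {μ : X → ℝ} (hμ : 0 ≤ μ) :
    0 ≤ minDistortion d μ :=
  Finset.le_inf' _ _ fun xhat _ => Finset.sum_nonneg fun x _ => mul_nonneg (d x xhat).2 (hμ x)

theorem abs_minDistortion_sub_le (d : X → Xhat → ℝ≥0) {D : ℝ} (hD : ∀ x xhat, (d x xhat : ℝ) ≤ D)
    (μ ν : X → ℝ) : |minDistortion d μ - minDistortion d ν| ≤ D * ell1 (μ - ν) := by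
  refine abs_inf'_sub_inf'_le _ fun xhat _ => ?_
  rw [← Finset.sum_sub_distrib]
  refine (Finset.abs_sum_le_sum_abs _ _).trans ?_
  unfold ell1
  rw [Finset.mul_sum]
  refine Finset.sum_le_sum fun x _ => ?_
  rw [← mul_sub, abs_mul, NNReal.abs_eq]
  exact mul_le_mul_of_nonneg_right (hD x xhat) (abs_nonneg _)

/-- The cost of a quantizer at an unnormalized belief. -/
def stageCost (O : M → stdSimplex ℝ M') (d : X → Xhat → ℝ≥0) (μ : X → ℝ) (Q : Quantizer X M) : ℝ :=
  ∑ y, minDistortion d (condMass O Q y μ)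

theorem beliefCost_eq_stageCost (O : M → stdSimplex ℝ M') (d : X → Xhat → ℝ≥0)
    (π : stdSimplex ℝ X) (Q : Quantizer X M) : beliefCost O d π Q = stageCost O d π.1 Q := by
  simp only [beliefCost, stageCost, minDistortion, condMass_apply, mul_assoc]

/-- State-action value at an unnormalized belief, for the value function `W`. -/
def qValue (T : X → stdSimplex ℝ X) (O : M → stdSimplex ℝ M') (d : X → Xhat → ℝ≥0) (β : ℝ)
    (W : (X → ℝ) → ℝ) (μ : X → ℝ) (Q : Quantizer X M) : ℝ :=
  stageCost O d μ Q + β * ∑ y, W (push T (condMass O Q y μ))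

/-- Regularity of value functions: superadditive, positively homogeneous, nonnegative on the
positive orthant and `K`-Lipschitz for the `ℓ¹` distance. -/
structure IsRegularValue (K : ℝ) (W : (X → ℝ) → ℝ) : Prop where
  lipschitz : ∀ μ ν, |W μ - W ν| ≤ K * ell1 (μ - ν)
  smul : ∀ (r : ℝ) (μ : X → ℝ), 0 ≤ r → W (r • μ) = r * W μ
  superadd : ∀ μ ν, W μ + W ν ≤ W (μ + ν)
  nonneg : ∀ μ : X → ℝ, 0 ≤ μ → 0 ≤ W μ

theorem IsRegularValue.zero_apply {K : ℝ} {W : (X → ℝ) → ℝ} (h : IsRegularValue K W) : W 0 = 0 := by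
  simpa using h.smul 0 0 le_rfl

theorem IsRegularValue.abs_le {K : ℝ} {W : (X → ℝ) → ℝ} (h : IsRegularValue K W) (μ : X → ℝ) :
    |W μ| ≤ K * ell1 μ := by
  simpa [h.zero_apply] using h.lipschitz μ 0

theorem IsRegularValue.sum_le {K : ℝ} {W : (X → ℝ) → ℝ} (h : IsRegularValue K W)
    {ι : Type*} (s : Finset ι) (μ : ι → X → ℝ) : ∑ i ∈ s, W (μ i) ≤ W (∑ i ∈ s, μ i) := by
  classical
  induction s using Finset.induction_on with
  | empty => simp [h.zero_apply]
  | insert i s hi ih =>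
    rw [Finset.sum_insert hi, Finset.sum_insert hi]
    exact (add_le_add le_rfl ih).trans (h.superadd _ _)

theorem isRegularValue_zero {K : ℝ} (hK : 0 ≤ K) :
    IsRegularValue K (fun _ : X → ℝ => (0 : ℝ)) where
  lipschitz μ ν := by simpa using mul_nonneg hK (ell1_nonneg (μ - ν))
  smul := by simp
  superadd := by simp
  nonneg := by simp

theorem isRegularValue_minDistortion (d : X → Xhat → ℝ≥0) {D : ℝ}
    (hD : ∀ x xhat, (d x xhat : ℝ) ≤ D) : IsRegularValue D (minDistortion d) where
  lipschitz := abs_minDistortion_sub_le d hD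
  smul _ μ hr := minDistortion_smul d hr μ
  superadd := minDistortion_add_le d
  nonneg _ := minDistortion_nonneg d

variable (T : X → stdSimplex ℝ X) (O : M → stdSimplex ℝ M') (d : X → Xhat → ℝ≥0) {β : ℝ}

/-- The state-action values inherit the regularity of the value function. -/
theorem IsRegularValue.stateAction (hβ0 : 0 ≤ β) {D K : ℝ} (hD : ∀ x xhat, (d x xhat : ℝ) ≤ D)
    (hK0 : 0 ≤ K) {W : (X → ℝ) → ℝ} (h : IsRegularValue K W) (Q : Quantizer X M) :
    IsRegularValue (D + β * K) (fun μ => qValue T O d β W μ Q) where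
  lipschitz μ ν := by
    have h1 : |stageCost O d μ Q - stageCost O d ν Q| ≤ D * ell1 (μ - ν) := by
      unfold stageCost
      rw [← Finset.sum_sub_distrib, ← sum_ell1_condMass O Q (μ - ν), Finset.mul_sum]
      refine (Finset.abs_sum_le_sum_abs _ _).trans (Finset.sum_le_sum fun y _ => ?_)
      rw [map_sub]
      exact abs_minDistortion_sub_le d hD _ _
    have h2 : |∑ y, W (push T (condMass O Q y μ)) - ∑ y, W (push T (condMass O Q y ν))| ≤
        K * ell1 (μ - ν) := by
      rw [← Finset.sum_sub_distrib]
      refine le_trans ?_ (mul_le_mul_of_nonneg_left (sum_ell1_push_condMass_le T O Q (μ - ν)) hK0)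
      rw [Finset.mul_sum]
      refine (Finset.abs_sum_le_sum_abs _ _).trans (Finset.sum_le_sum fun y _ => ?_)
      rw [map_sub, map_sub]
      exact h.lipschitz _ _
    calc _ = |(stageCost O d μ Q - stageCost O d ν Q) +
          β * (∑ y, W (push T (condMass O Q y μ)) - ∑ y, W (push T (condMass O Q y ν)))| := by
          unfold qValue; congr 1; ring
      _ ≤ D * ell1 (μ - ν) + β * (K * ell1 (μ - ν)) := by
          refine (abs_add_le _ _).trans (add_le_add h1 ?_)
          rw [abs_mul, abs_of_nonneg hβ0]
          exact mul_le_mul_of_nonneg_left h2 hβ0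
      _ = _ := by ring
  smul r μ hr := by
    simp only [qValue, stageCost, map_smul, h.smul _ _ hr, minDistortion_smul d hr,
      ← Finset.mul_sum]
    ring
  superadd μ ν := by
    simp only [qValue, stageCost, map_add]
    have h1 := Finset.sum_le_sum (s := Finset.univ) fun y (_ : y ∈ Finset.univ) =>
      minDistortion_add_le d (condMass O Q y μ) (condMass O Q y ν)
    have h2 := mul_le_mul_of_nonneg_left (Finset.sum_le_sum (s := Finset.univ)
      fun y (_ : y ∈ Finset.univ) =>
        h.superadd (push T (condMass O Q y μ)) (push T (condMass O Q y ν))) hβ0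
    simp only [Finset.sum_add_distrib] at h1 h2
    linarith
  nonneg μ hμ := add_nonneg
    (Finset.sum_nonneg fun y _ => minDistortion_nonneg d (condMass_nonneg O Q y hμ))
    (mul_nonneg hβ0 (Finset.sum_nonneg fun y _ =>
      h.nonneg _ (push_nonneg T (condMass_nonneg O Q y hμ))))

omit [Nonempty Xhat] in
-- Each condition is inherited by minima; for superadditivity, any single index bounds both minima
-- on the left.
theorem IsRegularValue.inf' {ι : Type*} {s : Finset ι} (hs : s.Nonempty) {K : ℝ}
    {F : ι → (X → ℝ) → ℝ} (h : ∀ i, IsRegularValue K (F i)) :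
    IsRegularValue K (fun μ => s.inf' hs fun i => F i μ) where
  lipschitz μ ν := abs_inf'_sub_inf'_le hs fun i _ => (h i).lipschitz μ ν
  smul r μ hr := by simp only [(h _).smul r μ hr, inf'_const_mul hs hr]
  superadd μ ν := (inf'_add_inf'_le hs _ _).trans
    (Finset.le_inf' _ _ fun i hi => (Finset.inf'_le _ hi).trans ((h i).superadd μ ν))
  nonneg μ hμ := Finset.le_inf' _ _ fun i _ => (h i).nonneg μ hμ

omit [Nonempty Xhat] in
-- Every regularity condition is a non-strict inequality or an equation, hence closed under
-- pointwise limits.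
theorem IsRegularValue.of_tendsto {K : ℝ} {F : ℕ → (X → ℝ) → ℝ} {W : (X → ℝ) → ℝ}
    (h : ∀ n, IsRegularValue K (F n)) (hF : ∀ μ, Tendsto (fun n => F n μ) atTop (𝓝 (W μ))) :
    IsRegularValue K W where
  lipschitz μ ν := le_of_tendsto' ((hF μ).sub (hF ν)).abs fun n => (h n).lipschitz μ ν
  smul r μ hr := tendsto_nhds_unique (hF _) <| by
    simp_rw [(h _).smul r μ hr]
    exact (hF μ).const_mul r
  superadd μ ν := le_of_tendsto_of_tendsto' ((hF μ).add (hF ν)) (hF _) fun n => (h n).superadd μ ν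
  nonneg μ hμ := ge_of_tendsto' (hF μ) fun n => (h n).nonneg μ hμ

variable [Fintype (Quantizer X M)] [Nonempty (Quantizer X M)]

/-- The Bellman operator on unnormalized beliefs. -/
def bellman (β : ℝ) (W : (X → ℝ) → ℝ) (μ : X → ℝ) : ℝ :=
  Finset.univ.inf' Finset.univ_nonempty fun Q : Quantizer X M => qValue T O d β W μ Q

/-- Contraction by `β` in the weighted norm `sup |W μ| / ell1 μ`, the natural one for homogeneous
functions. -/
theorem abs_bellman_sub_le (hβ0 : 0 ≤ β) {C : ℝ} (hC : 0 ≤ C) {W W' : (X → ℝ) → ℝ}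
    (h : ∀ μ, |W μ - W' μ| ≤ C * ell1 μ) (μ : X → ℝ) :
    |bellman T O d β W μ - bellman T O d β W' μ| ≤ β * C * ell1 μ := by
  refine abs_inf'_sub_inf'_le _ fun Q _ => ?_
  unfold qValue
  rw [add_sub_add_left_eq_sub, ← mul_sub, abs_mul, abs_of_nonneg hβ0, mul_assoc,
    ← Finset.sum_sub_distrib]
  refine mul_le_mul_of_nonneg_left ((Finset.abs_sum_le_sum_abs _ _).trans ?_) hβ0
  refine le_trans ?_ (mul_le_mul_of_nonneg_left (sum_ell1_push_condMass_le T O Q μ) hC)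
  rw [Finset.mul_sum]
  exact Finset.sum_le_sum fun y _ => h _

/-- The Bellman equation has a regular solution. -/
theorem exists_regular_bellman_fixedPoint (hβ0 : 0 ≤ β) (hβ1 : β < 1) {D : ℝ}
    (hD : ∀ x xhat, (d x xhat : ℝ) ≤ D) (hD0 : 0 ≤ D) :
    ∃ W, IsRegularValue (D / (1 - β)) W ∧ ∀ μ, bellman T O d β W μ = W μ := by
  have hK0 : 0 ≤ D / (1 - β) := div_nonneg hD0 (sub_nonneg.2 hβ1.le)
  -- `D / (1 - β)` is the fixed point of `K ↦ D + β * K`, so all iterates share one Lipschitz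
  -- constant.
  have hKeq : D + β * (D / (1 - β)) = D / (1 - β) := by
    have : 1 - β ≠ 0 := (sub_pos.2 hβ1).ne'
    field_simp
    ring_nf
  set F : ℕ → (X → ℝ) → ℝ := fun n => (bellman T O d β)^[n] fun _ => 0 with hF
  have hFs : ∀ n, F (n + 1) = bellman T O d β (F n) := fun n => Function.iterate_succ_apply' _ _ _
  have hreg : ∀ n, IsRegularValue (D / (1 - β)) (F n) := by
    intro n
    induction n with
    | zero => exact isRegularValue_zero hK0
    | succ n ih =>
      rw [hFs]
      refine IsRegularValue.inf' _ fun Q => ?_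
      rw [← hKeq]
      exact ih.stateAction T O d hβ0 hD hK0 Q
  have hdiff : ∀ n μ, |F n μ - F (n + 1) μ| ≤ (D / (1 - β)) * β ^ n * ell1 μ := by
    intro n
    induction n with
    | zero =>
      intro μ
      have := (hreg 1).abs_le μ
      simpa [hF] using this
    | succ n ih =>
      intro μ
      rw [hFs n, hFs (n + 1)]
      refine (abs_bellman_sub_le T O d hβ0 (mul_nonneg hK0 (pow_nonneg hβ0 n)) ih μ).trans
        (le_of_eq ?_)
      ring
  have hdist : ∀ μ n, dist (F n μ) (F (n + 1) μ) ≤ (D / (1 - β) * ell1 μ) * β ^ n := fun μ n => by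
    rw [Real.dist_eq]
    exact (hdiff n μ).trans (le_of_eq (by ring))
  have hlim : ∀ μ, ∃ w, Tendsto (fun n => F n μ) atTop (𝓝 w) := fun μ =>
    cauchySeq_tendsto_of_complete (cauchySeq_of_le_geometric β _ hβ1 (hdist μ))
  choose W hW using hlim
  refine ⟨W, IsRegularValue.of_tendsto hreg hW, fun μ => ?_⟩
  have hWn : ∀ n μ, |F n μ - W μ| ≤ (D / (1 - β) * β ^ n / (1 - β)) * ell1 μ := fun n μ => by
    have := dist_le_of_le_geometric_of_tendsto β _ hβ1 (hdist μ) (hW μ) n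
    rw [Real.dist_eq] at this
    exact this.trans (le_of_eq (by ring))
  -- The contraction estimate lets the operator pass to the limit of the iterates.
  have h1 : Tendsto (fun n => bellman T O d β (F n) μ) atTop (𝓝 (bellman T O d β W μ)) := by
    have h2 := (tendsto_pow_atTop_nhds_zero_of_lt_one hβ0 hβ1).const_mul
      (β * (D / (1 - β)) / (1 - β) * ell1 μ)
    rw [mul_zero] at h2
    refine tendsto_iff_dist_tendsto_zero.2 (squeeze_zero (fun _ => dist_nonneg) (fun n => ?_) h2)
    rw [Real.dist_eq]
    refine (abs_bellman_sub_le T O d hβ0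
      (div_nonneg (mul_nonneg hK0 (pow_nonneg hβ0 n)) (sub_nonneg.2 hβ1.le)) (hWn n) μ).trans
      (le_of_eq ?_)
    ring
  refine tendsto_nhds_unique h1 ?_
  simp_rw [← hFs]
  exact (hW μ).comp (tendsto_add_atTop_nat 1)

end Unnormalized

/-! ### Covering the simplex by the grid. -/

section GridApproximation

variable {X : Type*} [Fintype X]

theorem beliefDist_le_ell1 (π π' : stdSimplex ℝ X) : beliefDist π π' ≤ ell1 (π.1 - π'.1) := by
  refine Real.sqrt_le_iff.2 ⟨ell1_nonneg _, ?_⟩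
  calc ∑ x, (π.1 x - π'.1 x) ^ 2 = ∑ x, |π.1 x - π'.1 x| ^ 2 := by simp only [sq_abs]
    _ ≤ (∑ x, |π.1 x - π'.1 x|) ^ 2 := Finset.sum_sq_le_sq_sum_of_nonneg fun _ _ => abs_nonneg _

theorem ell1_le_card_mul_beliefDist (π π' : stdSimplex ℝ X) :
    ell1 (π.1 - π'.1) ≤ Fintype.card X * beliefDist π π' := by
  rw [← nsmul_eq_mul]
  refine Finset.sum_le_card_nsmul _ _ _ fun x _ => Real.abs_le_sqrt ?_
  exact Finset.single_le_sum (f := fun x => (π.1 x - π'.1 x) ^ 2) (fun _ _ => sq_nonneg _)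
    (Finset.mem_univ x)

theorem ell1_sub_comm (μ ν : X → ℝ) : ell1 (μ - ν) = ell1 (ν - μ) :=
  Finset.sum_congr rfl fun _ _ => abs_sub_comm _ _

theorem ell1_sub_le (μ ν ρ : X → ℝ) : ell1 (μ - ρ) ≤ ell1 (μ - ν) + ell1 (ν - ρ) := by
  unfold ell1
  rw [← Finset.sum_add_distrib]
  exact Finset.sum_le_sum fun _ _ => abs_sub_le _ _ _

/-- Round every `N * π x` down and give the missing units `r ≤ card X` to one letter `x₀`. Rounding
and correction together cost at most `(card X + r) / N` in `ℓ¹`. -/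
theorem exists_grid_beliefDist_le (N : ℕ+) (π : stdSimplex ℝ X) :
    ∃ p : Grid X N, beliefDist π p.1 ≤ 2 * Fintype.card X / (N : ℝ) := by
  classical
  have hN : (0 : ℝ) < N := by exact_mod_cast N.pos
  have hX : Nonempty X := by
    by_contra h
    rw [not_nonempty_iff] at h
    simpa using π.2.2
  obtain ⟨x₀⟩ := hX
  set k : X → ℕ := fun x => ⌊N * π.1 x⌋₊ with hk
  have hk1 : ∀ x, (k x : ℝ) ≤ N * π.1 x := fun x =>
    Nat.floor_le (mul_nonneg hN.le (π.2.1 x))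
  have hk2 : ∀ x, N * π.1 x < k x + 1 := fun x => Nat.lt_floor_add_one _
  have hπ : ∑ x, N * π.1 x = N := by rw [← Finset.mul_sum, π.2.2, mul_one]
  have hle : ∑ x, k x ≤ N := by
    have : (∑ x, (k x : ℝ)) ≤ N := (Finset.sum_le_sum fun x _ => hk1 x).trans hπ.le
    exact_mod_cast this
  obtain ⟨r, hr⟩ := Nat.exists_eq_add_of_le hle
  have hrR : (N : ℝ) = ∑ x, (k x : ℝ) + r := by exact_mod_cast hr
  have hrc : (r : ℝ) ≤ Fintype.card X := by
    have h1 : ∑ x, N * π.1 x ≤ ∑ x, ((k x : ℝ) + 1) := Finset.sum_le_sum fun x _ => (hk2 x).le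
    rw [hπ, Finset.sum_add_distrib] at h1
    simp only [Finset.sum_const, Finset.card_univ, nsmul_eq_mul, mul_one] at h1
    linarith
  set k' : X → ℕ := fun x => k x + if x = x₀ then r else 0 with hk'
  have hsum : ∑ x, k' x = N := by
    rw [hr, hk', Finset.sum_add_distrib]
    simp
  have hsumR : ∑ x, (k' x : ℝ) = N := by exact_mod_cast hsum
  let p : Grid X N := ⟨⟨fun x => (k' x : ℝ) / N, fun x => by positivity, by
    rw [← Finset.sum_div, hsumR, div_self hN.ne']⟩, k', hsum, fun _ => rfl⟩
  refine ⟨p, (beliefDist_le_ell1 _ _).trans ?_⟩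
  have hterm : ∀ x, |π.1 x - p.1.1 x| ≤ (1 + if x = x₀ then (r : ℝ) else 0) / N := by
    intro x
    have hpx : π.1 x - p.1.1 x = (N * π.1 x - k' x) / N := by
      change π.1 x - (k' x : ℝ) / N = _
      field_simp
    rw [hpx, abs_div, abs_of_pos hN]
    gcongr
    have h1 := hk1 x
    have h2 := hk2 x
    have h3 : (k' x : ℝ) = k x + if x = x₀ then (r : ℝ) else 0 := by
      simp only [hk']; push_cast; rfl
    have h4 : (0 : ℝ) ≤ if x = x₀ then (r : ℝ) else 0 := by positivity
    rw [h3, abs_le]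
    constructor <;> linarith
  calc ell1 (π.1 - p.1.1) ≤ ∑ x, (1 + if x = x₀ then (r : ℝ) else 0) / N :=
        Finset.sum_le_sum fun x _ => hterm x
    _ = (Fintype.card X + r) / N := by
        rw [← Finset.sum_div, Finset.sum_add_distrib]
        simp
    _ ≤ _ := by gcongr; linarith

/-- The bins of a nearest-neighbor map have `ℓ¹` diameter `O(1 / N)`. -/
theorem IsNearestNeighbor.ell1_sub_le {N : ℕ+} {q : stdSimplex ℝ X → Grid X N}
    (hq : IsNearestNeighbor q) {π π' : stdSimplex ℝ X} (h : q π = q π') :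
    ell1 (π.1 - π'.1) ≤ 4 * (Fintype.card X : ℝ) ^ 2 / (N : ℝ) := by
  -- Nearest means nearest in Euclidean distance; returning to `ℓ¹` costs one more factor `card X`.
  have hb : ∀ π, ell1 (π.1 - (q π).1.1) ≤ Fintype.card X * (2 * Fintype.card X / (N : ℝ)) := by
    intro π
    obtain ⟨p, hp⟩ := exists_grid_beliefDist_le N π
    refine (ell1_le_card_mul_beliefDist _ _).trans ?_
    gcongr
    exact (hq π p).trans hp
  have h1 := hb π
  have h2 := hb π'
  rw [ell1_sub_comm, ← h] at h2
  refine (_root_.ell1_sub_le _ (q π).1.1 _).trans ((add_le_add h1 h2).trans (le_of_eq ?_))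
  ring

end GridApproximation

/-! ### State-action values of the belief MDP -/

section BeliefValue

variable {X M M' Xhat : Type*} [Fintype X] [Fintype M'] [Fintype Xhat] [Nonempty Xhat]
  (T : X → stdSimplex ℝ X) (O : M → stdSimplex ℝ M') (d : X → Xhat → ℝ≥0)

/-- If the symbol has probability zero, every nonnegative term of its sum vanishes, so the default
value of the filter is irrelevant. -/
theorem outputProb_smul_beliefFilter (π : stdSimplex ℝ X) (Q : Quantizer X M) (y : M') :
    outputProb O π Q y • (beliefFilter O π Q y).1 = condMass O Q y π.1 := by
  ext x
  simp only [beliefFilter, Pi.smul_apply, smul_eq_mul, condMass_apply]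
  split_ifs with h
  · rw [h, zero_mul]
    exact ((Finset.sum_eq_zero_iff_of_nonneg fun x _ =>
      mul_nonneg ((O (Q x)).2.1 y) (π.2.1 x)).1 h x (Finset.mem_univ x)).symm
  · exact mul_div_cancel₀ _ h

theorem outputProb_smul_nextBelief (π : stdSimplex ℝ X) (Q : Quantizer X M) (y : M') :
    outputProb O π Q y • (nextBelief T O π Q y).1 = push T (condMass O Q y π.1) := by
  rw [← outputProb_smul_beliefFilter, map_smul]
  rfl

/-- Homogeneity absorbs the normalization of the filter, leaving a value at a linear image of `π`.
-/
theorem IsRegularValue.outputProb_mul {K : ℝ} {W : (X → ℝ) → ℝ} (h : IsRegularValue K W)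
    (π : stdSimplex ℝ X) (Q : Quantizer X M) (y : M') :
    outputProb O π Q y * W (nextBelief T O π Q y).1 = W (push T (condMass O Q y π.1)) := by
  rw [← h.smul _ _ (outputProb_nonneg O π Q y), outputProb_smul_nextBelief]

theorem IsRegularValue.measurable {K : ℝ} (hK : 0 ≤ K) {W : (X → ℝ) → ℝ}
    (h : IsRegularValue K W) : Measurable W := by
  have hL : LipschitzWith (K.toNNReal * Fintype.card X) W := by
    refine LipschitzWith.of_dist_le_mul fun μ ν => ?_
    rw [Real.dist_eq]
    refine (h.lipschitz μ ν).trans ?_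
    push_cast
    rw [Real.coe_toNNReal K hK, mul_assoc]
    refine mul_le_mul_of_nonneg_left ?_ hK
    rw [← nsmul_eq_mul]
    refine Finset.sum_le_card_nsmul _ _ _ fun x _ => ?_
    exact dist_le_pi_dist μ ν x
  exact hL.continuous.measurable

/-- The bridge between the belief MDP and the Bellman equation on unnormalized beliefs. -/
theorem actionValue_beliefMDP [Finite M] {K β : ℝ} (hβ0 : 0 ≤ β) {W : (X → ℝ) → ℝ} (h : IsRegularValue K W)
    (hK : 0 ≤ K) (π : stdSimplex ℝ X) (Q : Quantizer X M) :
    (beliefMDP T O d).actionValue (ENNReal.ofReal β) (fun π => ENNReal.ofReal (W π.1)) (π, Q) =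
      ENNReal.ofReal (qValue T O d β W π.1 Q) := by
  have hm : Measurable fun π : stdSimplex ℝ X => ENNReal.ofReal (W π.1) :=
    ((h.measurable hK).comp measurable_subtype_coe).ennreal_ofReal
  have hW : ∀ y, 0 ≤ W (push T (condMass O Q y π.1)) := fun y =>
    h.nonneg _ (push_nonneg T (condMass_nonneg O Q y π.2.1))
  have hint : ∫⁻ π', ENNReal.ofReal (W π'.1) ∂(beliefMDP T O d).P (π, Q) =
      ENNReal.ofReal (∑ y, W (push T (condMass O Q y π.1))) := by
    rw [ENNReal.ofReal_sum_of_nonneg fun y _ => hW y]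
    simp only [beliefMDP, beliefKernel, Kernel.coe_mk, lintegral_finsetSum_measure,
      lintegral_smul_measure, lintegral_dirac' _ hm, smul_eq_mul]
    refine Finset.sum_congr rfl fun y _ => ?_
    rw [← h.outputProb_mul T O, ENNReal.ofReal_mul (outputProb_nonneg O π Q y)]
  unfold MDP.actionValue qValue
  rw [hint, ← ENNReal.ofReal_mul hβ0, ← ENNReal.ofReal_add, ← beliefCost_eq_stageCost]
  · rfl
  · exact (beliefMDP T O d).cost_nonneg (π, Q)
  · exact mul_nonneg hβ0 (Finset.sum_nonneg fun y _ => hW y)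

end BeliefValue

theorem Fin.sum_eq_sum_snoc {α β : Type*} [Fintype α] [AddCommMonoid β] {n : ℕ}
    (f : (Fin (n + 1) → α) → β) :
    ∑ v, f v = ∑ v : Fin n → α, ∑ a, f (Fin.snoc (α := fun _ => α) v a) := by
  rw [← (Fin.snocEquiv fun _ => α).sum_comp, Fintype.sum_prod_type_right]
  rfl

/-! ### Randomized quantizers -/

section Randomized

variable {X M M' Xhat : Type*} [Fintype X] [Fintype M] [Fintype M'] [Fintype Xhat]
  [Fintype (Quantizer X M)]

/-- Draw the values `Q x` independently with laws `R x`; the marginal at `x₀` is `R x₀`. Thus any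
stochastic encoder is a mixture of deterministic quantizers. -/
theorem sum_quantizer_prod_mul (R : X → M → ℝ) (hR : ∀ x, ∑ m, R x m = 1) (x₀ : X) (h : M → ℝ) :
    ∑ Q : Quantizer X M, (∏ x, R x (Q x)) * h (Q x₀) = ∑ m, R x₀ m * h m := by
  classical
  -- Expand a product of sums in which `h` sits only in the factor at `x₀`.
  have h1 := Fintype.prod_sum fun (x : X) (m : M) => R x m * if x = x₀ then h m else 1
  have h2 : ∀ x, ∑ m, R x m * (if x = x₀ then h m else 1) =
      if x = x₀ then ∑ m, R x₀ m * h m else 1 := by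
    intro x
    split_ifs with hx
    · rw [hx]
    · simp [hR]
  simp only [h2, Finset.prod_mul_distrib, Finset.prod_ite_eq', Finset.mem_univ, if_true] at h1
  rw [h1]
  exact Fintype.sum_equiv (M := ℝ) (ι := Quantizer X M) (κ := X → M) (Equiv.refl (X → M)) _ _
    fun Q => rfl

theorem sum_quantizer_prod (R : X → M → ℝ) (hR : ∀ x, ∑ m, R x m = 1) :
    ∑ Q : Quantizer X M, ∏ x, R x (Q x) = 1 := by
  classical
  have h1 := Fintype.prod_sum fun (x : X) (m : M) => R x m
  simp only [hR, Finset.prod_const_one] at h1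
  rw [h1]
  exact Fintype.sum_equiv (M := ℝ) (ι := Quantizer X M) (κ := X → M) (Equiv.refl (X → M)) _ _
    fun Q => rfl

omit [Fintype X] [Fintype (Quantizer X M)] in
-- `R` is the conditional law of the channel input given the source letter; letters of mass zero get
-- a point mass.
theorem exists_stochastic_factor [Nonempty M] (A : X → M → ℝ) (hA : ∀ x m, 0 ≤ A x m) :
    ∃ R : X → M → ℝ, (∀ x m, 0 ≤ R x m) ∧ (∀ x, ∑ m, R x m = 1) ∧
      ∀ x m, A x m = (∑ m, A x m) * R x m := by
  classical
  obtain ⟨m₀⟩ := ‹Nonempty M›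
  have h : ∀ x, ∃ r : M → ℝ, (∀ m, 0 ≤ r m) ∧ ∑ m, r m = 1 ∧
      ∀ m, A x m = (∑ m, A x m) * r m := by
    intro x
    by_cases h0 : ∑ m, A x m = 0
    · refine ⟨fun m => if m = m₀ then 1 else 0, fun m => by positivity, by simp, fun m => ?_⟩
      rw [h0, zero_mul]
      exact (Finset.sum_eq_zero_iff_of_nonneg fun m _ => hA x m).1 h0 m (Finset.mem_univ m)
    · refine ⟨fun m => A x m / ∑ m, A x m,
        fun m => div_nonneg (hA x m) (Finset.sum_nonneg fun m _ => hA x m), ?_,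
        fun m => (mul_div_cancel₀ _ h0).symm⟩
      rw [← Finset.sum_div, div_self h0]
  choose R h1 h2 h3 using h
  exact ⟨R, h1, h2, h3⟩

variable [Nonempty Xhat] [Nonempty (Quantizer X M)]
  (T : X → stdSimplex ℝ X) (O : M → stdSimplex ℝ M') (d : X → Xhat → ℝ≥0)

/-- Randomized quantizers, given by the joint mass `A` of source and channel input symbols, do not
improve on the Bellman equation. -/
theorem IsRegularValue.le_randomized [Nonempty M] {β K : ℝ} (hβ0 : 0 ≤ β) {W : (X → ℝ) → ℝ}
    (h : IsRegularValue K W) (hW : ∀ μ, bellman T O d β W μ = W μ)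
    (A : X → M → ℝ) (hA : ∀ x m, 0 ≤ A x m) :
    W (fun x => ∑ m, A x m) ≤ ∑ y, minDistortion d (fun x => ∑ m, A x m * (O m).1 y) +
      β * ∑ y, W (push T fun x => ∑ m, A x m * (O m).1 y) := by
  obtain ⟨R, hR0, hR1, hAR⟩ := exists_stochastic_factor A hA
  set α : X → ℝ := fun x => ∑ m, A x m with hα
  set l : Quantizer X M → ℝ := fun Q => ∏ x, R x (Q x) with hl
  have hl0 : ∀ Q, 0 ≤ l Q := fun Q => Finset.prod_nonneg fun x _ => hR0 x _
  -- The randomized encoder is split into quantizers `Q` of weight `l Q`, each acting on the same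
  -- belief shape `α`.
  have hB : ∀ y, (fun x => ∑ m, A x m * (O m).1 y) = ∑ Q, condMass O Q y (l Q • α) := by
    intro y
    ext x
    rw [Finset.sum_apply]
    calc ∑ m, A x m * (O m).1 y = α x * ∑ m, R x m * (O m).1 y := by
          rw [Finset.mul_sum]
          exact Finset.sum_congr rfl fun m _ => by rw [hAR x m, mul_assoc]
      _ = α x * ∑ Q : Quantizer X M, l Q * (O (Q x)).1 y := by
          rw [← sum_quantizer_prod_mul R hR1 x fun m => (O m).1 y]
      _ = _ := by
          rw [Finset.mul_sum]
          refine Finset.sum_congr rfl fun Q _ => ?_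
          simp only [condMass_apply, Pi.smul_apply, smul_eq_mul]
          ring
  obtain ⟨D, -, hD⟩ := exists_distortion_bound d
  have hd := isRegularValue_minDistortion d hD
  simp_rw [hB]
  calc W α = ∑ Q : Quantizer X M, W (l Q • α) := by
        simp_rw [h.smul _ _ (hl0 _)]
        rw [← Finset.sum_mul, hl, sum_quantizer_prod R hR1, one_mul]
    _ ≤ ∑ Q : Quantizer X M, qValue T O d β W (l Q • α) Q := by
        refine Finset.sum_le_sum fun Q _ => ?_
        rw [← hW]
        exact Finset.inf'_le _ (Finset.mem_univ Q)
    _ = ∑ y, ∑ Q, minDistortion d (condMass O Q y (l Q • α)) +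
        β * ∑ y, ∑ Q, W (push T (condMass O Q y (l Q • α))) := by
        unfold qValue stageCost
        rw [Finset.sum_add_distrib, ← Finset.mul_sum, Finset.sum_comm,
          Finset.sum_comm (f := fun Q y => W (push T (condMass O Q y (l Q • α))))]
    -- Forgetting which quantizer was used merges the masses, and superadditivity says that this
    -- cannot lower the cost.
    _ ≤ _ := by
        refine add_le_add (Finset.sum_le_sum fun y _ => hd.sum_le _ _)
          (mul_le_mul_of_nonneg_left (Finset.sum_le_sum fun y _ => ?_) hβ0)
        rw [map_sum]
        exact h.sum_le _ _

end Randomized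

/-! ### Unnormalized beliefs in the coding problem -/

section CodingMass

variable {X M M' Xhat : Type*} [Fintype X] [Fintype M] [Fintype M']
  (T : X → stdSimplex ℝ X) (O : M → stdSimplex ℝ M') (π₀ : stdSimplex ℝ X) (γ : Encoder X M M')

/-- The joint probability of `X_{[0,t]}`, `M_{[0,t-1]}`, `M'_{[0,t-1]}`. -/
def priorProb : (t : ℕ) → (Fin (t + 1) → X) → (Fin t → M) → (Fin t → M') → ℝ
  | 0, x, _, _ => π₀.1 (x 0)
  | t + 1, x, m, m' => pathProb T O π₀ γ t (Fin.init x) m m' *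
      (T (x (Fin.last t).castSucc)).1 (x (Fin.last (t + 1)))

omit [Fintype M] in
open Classical in
-- Separates the encoder choice and channel use at time `t` from the past, uniformly in `t` although
-- `pathProb` treats time zero apart.
theorem pathProb_eq_priorProb_mul (t : ℕ) (x : Fin (t + 1) → X) (m : Fin (t + 1) → M)
    (m' : Fin (t + 1) → M') : pathProb T O π₀ γ t x m m' =
      priorProb T O π₀ γ t x (Fin.init m) (Fin.init m') *
        (if m (Fin.last t) = γ t x (Fin.init m) (Fin.init m') then 1 else 0) *
        (O (m (Fin.last t))).1 (m' (Fin.last t)) := by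
  cases t with
  | zero =>
    have h1 : (Fin.init m : Fin 0 → M) = Fin.elim0 := Subsingleton.elim _ _
    have h2 : (Fin.init m' : Fin 0 → M') = Fin.elim0 := Subsingleton.elim _ _
    rw [h1, h2]
    rfl
  | succ t => rfl

omit [Fintype M] in
theorem priorProb_nonneg : ∀ (t : ℕ) (x : Fin (t + 1) → X) (m : Fin t → M) (m' : Fin t → M'),
    0 ≤ priorProb T O π₀ γ t x m m'
  | 0, x, _, _ => π₀.2.1 _
  | t + 1, x, m, m' => by
    refine mul_nonneg ?_ ((T _).2.1 _)
    rw [pathProb_eq_priorProb_mul]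
    exact mul_nonneg (mul_nonneg (priorProb_nonneg t _ _ _) (by positivity)) ((O _).2.1 _)

/-- `x ↦ P(X_t = x, M'_{[0,t-1]} = m')`. -/
def predMass (t : ℕ) (m' : Fin t → M') (x : X) : ℝ :=
  ∑ xs : Fin t → X, ∑ m : Fin t → M, priorProb T O π₀ γ t (Fin.snoc (α := fun _ => X) xs x) m m'

/-- `x ↦ P(X_t = x, M'_{[0,t]} = m')`. -/
def filterMass (t : ℕ) (m' : Fin (t + 1) → M') (x : X) : ℝ :=
  ∑ xs : Fin t → X, ∑ m : Fin (t + 1) → M,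
    pathProb T O π₀ γ t (Fin.snoc (α := fun _ => X) xs x) m m'

open Classical in
/-- `(x, u) ↦ P(X_t = x, M_t = u, M'_{[0,t-1]} = m')`. -/
def jointMass (t : ℕ) (m' : Fin t → M') (x : X) (u : M) : ℝ :=
  ∑ xs : Fin t → X, ∑ m : Fin t → M,
    priorProb T O π₀ γ t (Fin.snoc (α := fun _ => X) xs x) m m' *
      if u = γ t (Fin.snoc (α := fun _ => X) xs x) m m' then 1 else 0

theorem jointMass_nonneg (t : ℕ) (m' : Fin t → M') (x : X) (u : M) :
    0 ≤ jointMass T O π₀ γ t m' x u :=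
  Finset.sum_nonneg fun _ _ => Finset.sum_nonneg fun _ _ =>
    mul_nonneg (priorProb_nonneg T O π₀ γ t _ _ _) (by positivity)

theorem sum_jointMass (t : ℕ) (m' : Fin t → M') (x : X) :
    ∑ u, jointMass T O π₀ γ t m' x u = predMass T O π₀ γ t m' x := by
  unfold jointMass predMass
  rw [Finset.sum_comm]
  refine Finset.sum_congr rfl fun xs _ => ?_
  rw [Finset.sum_comm]
  refine Finset.sum_congr rfl fun m _ => ?_
  classical simp

theorem filterMass_snoc (t : ℕ) (m' : Fin t → M') (y : M') (x : X) :
    filterMass T O π₀ γ t (Fin.snoc (α := fun _ => M') m' y) x =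
      ∑ u, jointMass T O π₀ γ t m' x u * (O u).1 y := by
  unfold filterMass jointMass
  simp_rw [Finset.sum_mul]
  refine Eq.trans (Finset.sum_congr rfl fun xs _ => ?_) Finset.sum_comm
  rw [Fin.sum_eq_sum_snoc, Finset.sum_comm]
  refine Finset.sum_congr rfl fun u _ => Finset.sum_congr rfl fun m _ => ?_
  rw [pathProb_eq_priorProb_mul]
  classical simp only [Fin.init_snoc, Fin.snoc_last]

theorem predMass_nonneg (t : ℕ) (m' : Fin t → M') : 0 ≤ predMass T O π₀ γ t m' :=
  fun _ => Finset.sum_nonneg fun _ _ => Finset.sum_nonneg fun _ _ =>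
    priorProb_nonneg T O π₀ γ t _ _ _

theorem predMass_zero (m' : Fin 0 → M') : predMass T O π₀ γ 0 m' = π₀.1 := by
  ext x
  simp [predMass, priorProb, Fin.snoc]

theorem predMass_succ (t : ℕ) (m' : Fin (t + 1) → M') :
    predMass T O π₀ γ (t + 1) m' = push T (filterMass T O π₀ γ t m') := by
  ext x'
  rw [push_apply]
  unfold predMass filterMass
  rw [Fin.sum_eq_sum_snoc, Finset.sum_comm]
  refine Finset.sum_congr rfl fun x _ => ?_
  rw [Finset.mul_sum]
  refine Finset.sum_congr rfl fun xs _ => ?_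
  rw [Finset.mul_sum]
  refine Finset.sum_congr rfl fun m _ => ?_
  simp only [priorProb, Fin.init_snoc, Fin.snoc_last, Fin.snoc_castSucc]
  rw [mul_comm]

/-- The decoder sees only the received word, so the paths enter only through the mass of the current
source letter jointly with that word. -/
theorem expectedDistortion_eq (d : X → Xhat → ℝ≥0) (γd : Decoder M' Xhat) (t : ℕ) :
    expectedDistortion T O d π₀ γ γd t =
      ∑ m' : Fin t → M', ∑ y, ∑ x, (d x (γd t (Fin.snoc (α := fun _ => M') m' y)) : ℝ) *
        filterMass T O π₀ γ t (Fin.snoc (α := fun _ => M') m' y) x := by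
  unfold expectedDistortion filterMass
  rw [← Fin.sum_eq_sum_snoc fun m' : Fin (t + 1) → M' => ∑ x, (d x (γd t m') : ℝ) *
    ∑ xs : Fin t → X, ∑ m : Fin (t + 1) → M,
      pathProb T O π₀ γ t (Fin.snoc (α := fun _ => X) xs x) m m']
  rw [Fin.sum_eq_sum_snoc]
  simp_rw [Finset.mul_sum, Fin.snoc_last]
  rw [Finset.sum_comm, Finset.sum_comm (t := (Finset.univ : Finset X))
    (s := (Finset.univ : Finset (Fin (t + 1) → M')))]
  refine Finset.sum_congr rfl fun x _ => ?_
  rw [Finset.sum_comm (t := (Finset.univ : Finset (Fin t → X)))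
    (s := (Finset.univ : Finset (Fin (t + 1) → M')))]
  refine Finset.sum_congr rfl fun xs _ => ?_
  rw [Finset.sum_comm]
  refine Finset.sum_congr rfl fun m' _ => Finset.sum_congr rfl fun m _ => ?_
  rw [mul_comm]

theorem expectedDistortion_nonneg (d : X → Xhat → ℝ≥0) (γd : Decoder M' Xhat) (t : ℕ) :
    0 ≤ expectedDistortion T O d π₀ γ γd t := by
  rw [expectedDistortion_eq]
  refine Finset.sum_nonneg fun m' _ => Finset.sum_nonneg fun y _ => Finset.sum_nonneg fun x _ =>
    mul_nonneg (NNReal.coe_nonneg _) ?_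
  rw [filterMass_snoc]
  exact Finset.sum_nonneg fun u _ => mul_nonneg (jointMass_nonneg T O π₀ γ _ _ _ _) ((O u).2.1 y)

theorem sum_predMass (t : ℕ) : ∑ m' : Fin t → M', ∑ x, predMass T O π₀ γ t m' x = 1 := by
  induction t with
  | zero => simp [predMass_zero, π₀.2.2]
  | succ t ih =>
    rw [← ih, Fin.sum_eq_sum_snoc]
    refine Finset.sum_congr rfl fun m' _ => ?_
    simp_rw [predMass_succ, sum_push, filterMass_snoc, ← sum_jointMass]
    rw [Finset.sum_comm]
    refine Finset.sum_congr rfl fun x _ => ?_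
    rw [Finset.sum_comm]
    refine Finset.sum_congr rfl fun u _ => ?_
    rw [← Finset.mul_sum, (O u).2.2, mul_one]

end CodingMass

/-! ### Verification lemmas for the coding problem -/

section CodingValue

variable {X M M' Xhat : Type*} [Fintype X] [Fintype M] [Fintype M'] [Fintype Xhat]
  [Nonempty Xhat] (T : X → stdSimplex ℝ X) (O : M → stdSimplex ℝ M') (d : X → Xhat → ℝ≥0)
  (π₀ : stdSimplex ℝ X) {β K : ℝ} {W : (X → ℝ) → ℝ}

/-- For each received word, past source letters and channel inputs act as private randomness of the
encoder, so the bound for randomized quantizers applies to `jointMass`. -/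
theorem IsRegularValue.sum_predMass_le_step [Fintype (Quantizer X M)] [Nonempty (Quantizer X M)]
    [Nonempty M] (hβ0 : 0 ≤ β) (h : IsRegularValue K W) (hW : ∀ μ, bellman T O d β W μ = W μ)
    (γe : Encoder X M M') (γd : Decoder M' Xhat) (t : ℕ) :
    ∑ m' : Fin t → M', W (predMass T O π₀ γe t m') ≤ expectedDistortion T O d π₀ γe γd t +
      β * ∑ m' : Fin (t + 1) → M', W (predMass T O π₀ γe (t + 1) m') := by
  rw [expectedDistortion_eq, Fin.sum_eq_sum_snoc, Finset.mul_sum, ← Finset.sum_add_distrib]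
  refine Finset.sum_le_sum fun m' _ => ?_
  have h1 := h.le_randomized T O d hβ0 hW (jointMass T O π₀ γe t m')
    (jointMass_nonneg T O π₀ γe t m')
  simp_rw [sum_jointMass, ← filterMass_snoc] at h1
  refine h1.trans ?_
  simp_rw [predMass_succ]
  gcongr with y
  exact Finset.inf'_le _ (Finset.mem_univ _)

/-- The value of the Bellman equation is a lower bound for the distortion of every code. -/
theorem IsRegularValue.le_discountedDistortion [Fintype (Quantizer X M)]
    [Nonempty (Quantizer X M)] [Nonempty M] (hβ0 : 0 ≤ β) (hβ1 : β < 1) (hK : 0 ≤ K)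
    (h : IsRegularValue K W) (hW : ∀ μ, bellman T O d β W μ = W μ)
    (γe : Encoder X M M') (γd : Decoder M' Xhat) :
    ENNReal.ofReal (W π₀.1) ≤ discountedDistortion T O d β π₀ γe γd := by
  set E := expectedDistortion T O d π₀ γe γd
  have hE : ∀ t, 0 ≤ β ^ t * E t := fun t =>
    mul_nonneg (pow_nonneg hβ0 t) (expectedDistortion_nonneg T O π₀ γe d γd t)
  -- The masses over all received words add up to one, which bounds the total value uniformly in
  -- time.
  have hbound : ∀ n, ∑ m' : Fin n → M', W (predMass T O π₀ γe n m') ≤ K := by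
    intro n
    calc _ ≤ ∑ m' : Fin n → M', K * ∑ x, predMass T O π₀ γe n m' x := by
          refine Finset.sum_le_sum fun m' _ => (le_abs_self _).trans ((h.abs_le _).trans_eq ?_)
          congr 1
          exact Finset.sum_congr rfl fun x _ => abs_of_nonneg (predMass_nonneg T O π₀ γe n m' x)
      _ = K := by rw [← Finset.mul_sum, sum_predMass, mul_one]
  have hpartial : ∀ n, W π₀.1 ≤ ∑ t ∈ Finset.range n, β ^ t * E t +
      β ^ n * ∑ m' : Fin n → M', W (predMass T O π₀ γe n m') := by
    intro n
    induction n with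
    | zero => simp [predMass_zero]
    | succ n ih =>
      rw [Finset.sum_range_succ]
      have := mul_le_mul_of_nonneg_left
        (h.sum_predMass_le_step T O d π₀ hβ0 hW γe γd n) (pow_nonneg hβ0 n)
      refine ih.trans ((add_le_add le_rfl this).trans_eq ?_)
      ring
  have hlim : Tendsto (fun n : ℕ => discountedDistortion T O d β π₀ γe γd +
      ENNReal.ofReal (β ^ n * K)) atTop
      (𝓝 (discountedDistortion T O d β π₀ γe γd + ENNReal.ofReal (0 * K))) :=
    tendsto_const_nhds.add (ENNReal.tendsto_ofReal
      ((tendsto_pow_atTop_nhds_zero_of_lt_one hβ0 hβ1).mul_const K))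
  rw [zero_mul, ENNReal.ofReal_zero, add_zero] at hlim
  refine ge_of_tendsto' hlim fun n => ?_
  calc ENNReal.ofReal (W π₀.1) ≤ ENNReal.ofReal (∑ t ∈ Finset.range n, β ^ t * E t + β ^ n * K) :=
        ENNReal.ofReal_le_ofReal ((hpartial n).trans
          (add_le_add le_rfl (mul_le_mul_of_nonneg_left (hbound n) (pow_nonneg hβ0 n))))
    _ = ∑ t ∈ Finset.range n, ENNReal.ofReal (β ^ t * E t) + ENNReal.ofReal (β ^ n * K) := by
        rw [ENNReal.ofReal_add (Finset.sum_nonneg fun t _ => hE t)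
          (mul_nonneg (pow_nonneg hβ0 n) hK), ENNReal.ofReal_sum_of_nonneg fun t _ => hE t]
    _ ≤ _ := add_le_add (ENNReal.sum_le_tsum _) le_rfl

variable (g : stdSimplex ℝ X → Quantizer X M)

omit [Fintype Xhat] [Nonempty Xhat] in
-- Given the received word, the channel input is a function of the current source letter, so the
-- joint mass lives on the graph of one quantizer.
theorem jointMass_walrandVaraiya (t : ℕ) (m' : Fin t → M') (x : X) (y : M') :
    ∑ u, jointMass T O π₀ (walrandVaraiyaEncoder T O π₀ g) t m' x u * (O u).1 y =
      condMass O (g (predictor T O π₀ g t m')) y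
        (predMass T O π₀ (walrandVaraiyaEncoder T O π₀ g) t m') x := by
  classical
  have h : ∀ u, jointMass T O π₀ (walrandVaraiyaEncoder T O π₀ g) t m' x u =
      if u = g (predictor T O π₀ g t m') x then
        predMass T O π₀ (walrandVaraiyaEncoder T O π₀ g) t m' x else 0 := by
    intro u
    simp only [jointMass, predMass, walrandVaraiyaEncoder, Fin.snoc_last]
    split_ifs <;> simp
  simp only [h, condMass_apply]
  simp [mul_comm]

omit [Fintype Xhat] [Nonempty Xhat] in
theorem filterMass_walrandVaraiya (t : ℕ) (m' : Fin t → M') (y : M') :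
    filterMass T O π₀ (walrandVaraiyaEncoder T O π₀ g) t (Fin.snoc (α := fun _ => M') m' y) =
      condMass O (g (predictor T O π₀ g t m')) y
        (predMass T O π₀ (walrandVaraiyaEncoder T O π₀ g) t m') := by
  ext x
  rw [filterMass_snoc, jointMass_walrandVaraiya]

omit [Fintype Xhat] [Nonempty Xhat] in
-- The factor `r` is the accumulated product of symbol probabilities. It is zero on impossible
-- words, where the predictor carries only default values.
theorem predMass_walrandVaraiya (t : ℕ) (m' : Fin t → M') :
    ∃ r : ℝ, 0 ≤ r ∧ predMass T O π₀ (walrandVaraiyaEncoder T O π₀ g) t m' =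
      r • (predictor T O π₀ g t m').1 := by
  induction t with
  | zero => exact ⟨1, zero_le_one, by rw [predMass_zero, one_smul]; rfl⟩
  | succ t ih =>
    obtain ⟨r, hr, h⟩ := ih (Fin.init m')
    refine ⟨r * outputProb O (predictor T O π₀ g t (Fin.init m'))
      (g (predictor T O π₀ g t (Fin.init m'))) (m' (Fin.last t)),
      mul_nonneg hr (outputProb_nonneg O _ _ _), ?_⟩
    have h1 := filterMass_walrandVaraiya T O π₀ g t (Fin.init m') (m' (Fin.last t))
    rw [Fin.snoc_init_self] at h1
    rw [predMass_succ, h1, h, map_smul, map_smul, mul_smul, predictor, outputProb_smul_nextBelief]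

/-- A policy that is greedy up to `k` for `W` yields a nearly optimal code. -/
theorem IsRegularValue.encoderDistortion_le (hβ0 : 0 ≤ β) (hK : 0 ≤ K)
    (h : IsRegularValue K W) {k A : ℝ} (hA0 : 0 ≤ A) (hA : k + β * A ≤ A)
    (hg : ∀ π : stdSimplex ℝ X, qValue T O d β W π.1 (g π) ≤ W π.1 + k) :
    encoderDistortion T O d β π₀ (walrandVaraiyaEncoder T O π₀ g) ≤
      ENNReal.ofReal (W π₀.1 + A) := by
  set γe := walrandVaraiyaEncoder T O π₀ g with hγe
  -- The decoder picks a reproduction letter minimizing the conditional distortion of each received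
  -- word.
  obtain ⟨γd, hγd⟩ : ∃ γd : Decoder M' Xhat, ∀ (t : ℕ) (m' : Fin (t + 1) → M'),
      minDistortion d (filterMass T O π₀ γe t m') =
        ∑ x, (d x (γd t m') : ℝ) * filterMass T O π₀ γe t m' x := by
    have hdec : ∀ (t : ℕ) (m' : Fin (t + 1) → M'), ∃ xhat : Xhat,
        minDistortion d (filterMass T O π₀ γe t m') =
          ∑ x, (d x xhat : ℝ) * filterMass T O π₀ γe t m' x := fun t m' => by
      obtain ⟨xhat, -, hx⟩ := Finset.univ.exists_mem_eq_inf' Finset.univ_nonempty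
        fun xhat : Xhat => ∑ x, (d x xhat : ℝ) * filterMass T O π₀ γe t m' x
      exact ⟨xhat, hx⟩
    choose γd hγd using hdec
    exact ⟨γd, hγd⟩
  refine (iInf_le _ γd).trans ?_
  set E := expectedDistortion T O d π₀ γe γd with hE
  have hE0 : ∀ t, 0 ≤ β ^ t * E t := fun t =>
    mul_nonneg (pow_nonneg hβ0 t) (expectedDistortion_nonneg T O π₀ γe d γd t)
  obtain ⟨D, -, hD⟩ := exists_distortion_bound d
  -- `S` is the expected remaining cost bound: the value `W` plus a reserve `A` per unit of mass,
  -- which pays for the greedy error `k` at every step.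
  set S : ℕ → ℝ := fun t => ∑ m' : Fin t → M',
    (W (predMass T O π₀ γe t m') + A * ∑ x, predMass T O π₀ γe t m' x) with hS
  have hS0 : ∀ t, 0 ≤ S t := fun t => Finset.sum_nonneg fun m' _ =>
    add_nonneg (h.nonneg _ (predMass_nonneg T O π₀ γe t m'))
      (mul_nonneg hA0 (Finset.sum_nonneg fun x _ => predMass_nonneg T O π₀ γe t m' x))
  have hstep : ∀ t, E t + β * S (t + 1) ≤ S t := by
    intro t
    simp only [hE, hS]
    rw [expectedDistortion_eq, Fin.sum_eq_sum_snoc, Finset.mul_sum, ← Finset.sum_add_distrib]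
    refine Finset.sum_le_sum fun m' _ => ?_
    obtain ⟨r, hr, hrm⟩ := predMass_walrandVaraiya T O π₀ g t m'
    set π := predictor T O π₀ g t m' with hπ
    have hmass : ∀ μ : X → ℝ, ∑ y, ∑ x, push T (condMass O (g π) y μ) x = ∑ x, μ x := fun μ => by
      simp_rw [sum_push]
      rw [Finset.sum_comm]
      exact Finset.sum_congr rfl fun x _ => sum_condMass O (g π) μ x
    simp_rw [← hγd, predMass_succ, hγe, filterMass_walrandVaraiya, ← hπ, hrm,
      Finset.sum_add_distrib, ← Finset.mul_sum, hmass]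
    -- Homogeneity of the state-action value reduces the step to the normalized predictor, where the
    -- greedy bound is assumed.
    have h1 := (h.stateAction T O d hβ0 hD hK (g π)).smul r π.1 hr
    have h2 : ∑ x, (r • π.1) x = r := by
      simp only [Pi.smul_apply, smul_eq_mul]
      rw [← Finset.mul_sum, π.2.2, mul_one]
    have h3 := mul_le_mul_of_nonneg_left (hg π) hr
    have h4 := mul_le_mul_of_nonneg_left hA hr
    rw [h2, h.smul r _ hr]
    simp only [qValue, stageCost] at h1 h3
    nlinarith
  have hpartial : ∀ n, ∑ t ∈ Finset.range n, β ^ t * E t + β ^ n * S n ≤ W π₀.1 + A := by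
    intro n
    induction n with
    | zero => simp [hS, predMass_zero, π₀.2.2]
    | succ n ih =>
      rw [Finset.sum_range_succ]
      have := mul_le_mul_of_nonneg_left (hstep n) (pow_nonneg hβ0 n)
      refine le_trans (le_of_eq ?_) ((add_le_add le_rfl this).trans ih)
      ring
  unfold discountedDistortion
  rw [ENNReal.tsum_eq_iSup_nat]
  refine iSup_le fun n => ?_
  rw [← ENNReal.ofReal_sum_of_nonneg fun t _ => hE0 t]
  refine ENNReal.ofReal_le_ofReal (le_trans ?_ (hpartial n))
  exact le_add_of_nonneg_right (mul_nonneg (pow_nonneg hβ0 n) (hS0 n))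

end CodingValue

/-! ### Quantization of the belief MDP. -/

section BeliefQuantization

variable {X M M' Xhat : Type*} [Fintype X] [Fintype M] [Fintype M'] [Fintype Xhat]
  [Nonempty Xhat] (T : X → stdSimplex ℝ X) (O : M → stdSimplex ℝ M') (d : X → Xhat → ℝ≥0)
  {β K D : ℝ} {W : (X → ℝ) → ℝ}

theorem beliefMDP_cost_le (hD : ∀ x xhat, (d x xhat : ℝ) ≤ D)
    (πQ : stdSimplex ℝ X × Quantizer X M) : (beliefMDP T O d).cost πQ ≤ D := by
  -- With zero value and zero discount the state-action value is the stage cost, bounded by `D`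
  -- times an `ℓ¹` norm equal to one.
  have h := ((isRegularValue_zero (X := X) le_rfl).stateAction T O d (β := 0) le_rfl hD le_rfl
    πQ.2).abs_le πQ.1.1
  have h1 : (beliefMDP T O d).cost πQ = stageCost O d πQ.1.1 πQ.2 :=
    beliefCost_eq_stageCost O d πQ.1 πQ.2
  rw [h1]
  simpa [ell1_coe, qValue] using (le_abs_self _).trans h

theorem IsRegularValue.apply_le_of_ell1_le (hK : 0 ≤ K) (h : IsRegularValue K W) {μ ν : X → ℝ}
    {δ : ℝ} (hδ : ell1 (μ - ν) ≤ δ) : W μ ≤ W ν + K * δ := by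
  have h1 := (abs_sub_le_iff.1 (h.lipschitz μ ν)).1
  have h2 := mul_le_mul_of_nonneg_left hδ hK
  linarith

variable [Fintype (Quantizer X M)] [Nonempty (Quantizer X M)]

omit [Fintype M] in
theorem bellman_le_qValue (hW : ∀ μ, bellman T O d β W μ = W μ) (μ : X → ℝ) (Q : Quantizer X M) :
    W μ ≤ qValue T O d β W μ Q := by
  conv_lhs => rw [← hW]
  exact Finset.inf'_le _ (Finset.mem_univ Q)

theorem IsRegularValue.le_actionValue_beliefMDP (hβ0 : 0 ≤ β) (hK : 0 ≤ K)
    (h : IsRegularValue K W) (hW : ∀ μ, bellman T O d β W μ = W μ)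
    (πQ : stdSimplex ℝ X × Quantizer X M) : ENNReal.ofReal (W πQ.1.1) ≤
      (beliefMDP T O d).actionValue (ENNReal.ofReal β) (fun π => ENNReal.ofReal (W π.1)) πQ := by
  rw [actionValue_beliefMDP T O d hβ0 h hK πQ.1 πQ.2]
  exact ENNReal.ofReal_le_ofReal (bellman_le_qValue T O d hW _ _)

theorem IsRegularValue.le_optimalCost_beliefMDP (hβ0 : 0 ≤ β) (hβ1 : β < 1) (hK : 0 ≤ K)
    (h : IsRegularValue K W) (hW : ∀ μ, bellman T O d β W μ = W μ) (π₀ : stdSimplex ℝ X) :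
    ENNReal.ofReal (W π₀.1) ≤ (beliefMDP T O d).optimalCost β π₀ := by
  refine le_iInf fun f => (h.le_actionValue_beliefMDP T O d hβ0 hK hW
    (π₀, f.act 0 (fun _ => π₀, Fin.elim0))).trans ?_
  refine MDP.actionValue_le_discountedCost _ hβ0 hβ1
    ((h.measurable hK).comp measurable_subtype_coe).ennreal_ofReal
    (C := ENNReal.ofReal K) ENNReal.ofReal_ne_top (fun π => ?_)
    (h.le_actionValue_beliefMDP T O d hβ0 hK hW) f π₀
  refine ENNReal.ofReal_le_ofReal ((le_abs_self _).trans ((h.abs_le _).trans_eq ?_))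
  rw [ell1_coe, mul_one]

/-- An optimal policy of a finite approximation of the belief MDP whose bins have `ℓ¹` diameter at
most `δ` is almost greedy with respect to the value function. -/
theorem IsRegularValue.qValue_optimal_quantize_le (hβ0 : 0 ≤ β) (hβ1 : β < 1)
    (hD : ∀ x xhat, (d x xhat : ℝ) ≤ D) (hK : 0 ≤ K) (hDK : D + β * K = K)
    (h : IsRegularValue K W) (hW : ∀ μ, bellman T O d β W μ = W μ)
    {G : Type*} [Fintype G] [MeasurableSpace G] [MeasurableSingletonClass G]
    {q : stdSimplex ℝ X → G} (hq : Measurable q) (ν : Measure (stdSimplex ℝ X))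
    [IsProbabilityMeasure ν] (hν : ∀ i, 0 < ν (q ⁻¹' {i})) {δ : ℝ} (hδ0 : 0 ≤ δ)
    (hδ : ∀ π π', q π = q π' → ell1 (π.1 - π'.1) ≤ δ) {γ : G → Quantizer X M}
    (hγ : ((beliefMDP T O d).quantize q hq ν hν).IsOptimal β
      (Policy.stationary γ Measurable.of_discrete)) (π : stdSimplex ℝ X) :
    qValue T O d β W π.1 (γ (q π)) ≤ W π.1 + 3 * (2 * (K * δ) / (1 - β)) := by
  have hβ : 0 < 1 - β := sub_pos.2 hβ1
  have hKδ : 0 ≤ K * δ := mul_nonneg hK hδ0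
  -- Values vary by at most `ε = K * δ` on a bin, and `a` solves `2 * ε + β * a = a`.
  set a : ℝ := 2 * (K * δ) / (1 - β) with ha
  have ha0 : 0 ≤ a := by positivity
  have haeq : 2 * (K * δ) + β * a = a := by
    rw [ha]
    field_simp
    ring
  have hWnn : ∀ π : stdSimplex ℝ X, 0 ≤ W π.1 := fun π => h.nonneg _ π.2.1
  have hreg : ∀ Q : Quantizer X M, IsRegularValue K fun μ => qValue T O d β W μ Q := fun Q => by
    have := h.stateAction T O d hβ0 hD hK Q
    rwa [hDK] at this
  have hQnn : ∀ (π : stdSimplex ℝ X) (Q : Quantizer X M), 0 ≤ qValue T O d β W π.1 Q := fun π Q =>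
    (hreg Q).nonneg _ π.2.1
  have key := MDP.actionValue_optimal_quantize_le (beliefMDP T O d) hq ν hν hβ0 hβ1
    (beliefMDP_cost_le T O d hD) (V := fun π => ENNReal.ofReal (W π.1))
    (C := ENNReal.ofReal K) ENNReal.ofReal_ne_top
    (fun π => ENNReal.ofReal_le_ofReal ((le_abs_self _).trans ((h.abs_le _).trans_eq
      (by rw [ell1_coe, mul_one]))))
    (h.le_actionValue_beliefMDP T O d hβ0 hK hW)
    (fun π => by
      obtain ⟨Q, -, hQ⟩ := Finset.univ.exists_mem_eq_inf' Finset.univ_nonempty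
        fun Q : Quantizer X M => qValue T O d β W π.1 Q
      refine ⟨Q, ?_⟩
      rw [actionValue_beliefMDP T O d hβ0 h hK, ← hQ]
      exact (congrArg ENNReal.ofReal (hW π.1)).le)
    (ε := ENNReal.ofReal (K * δ)) (a := ENNReal.ofReal a)
    (by
      rw [← ENNReal.ofReal_ofNat, ← ENNReal.ofReal_mul zero_le_two, ← ENNReal.ofReal_mul hβ0,
        ← ENNReal.ofReal_add (by positivity) (by positivity), haeq])
    (fun π π' hππ => by
      rw [← ENNReal.ofReal_add (hWnn _) hKδ]
      exact ENNReal.ofReal_le_ofReal (h.apply_le_of_ell1_le hK (hδ _ _ hππ)))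
    (fun π π' Q hππ => by
      rw [actionValue_beliefMDP T O d hβ0 h hK, actionValue_beliefMDP T O d hβ0 h hK,
        ← ENNReal.ofReal_add (hQnn _ _) hKδ]
      exact ENNReal.ofReal_le_ofReal ((hreg Q).apply_le_of_ell1_le hK (hδ _ _ hππ)))
    hγ π
  rw [actionValue_beliefMDP T O d hβ0 h hK, ← ENNReal.ofReal_ofNat,
    ← ENNReal.ofReal_mul (by norm_num), ← ENNReal.ofReal_add (hWnn _) (by positivity)] at key
  exact (ENNReal.ofReal_le_ofReal_iff (add_nonneg (hWnn _) (by positivity))).1 key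

end BeliefQuantization

end

/-! ### The main theorem: both problems are compared with `W π₀`. -/

theorem mainTheorem3
    {X M M' Xhat : Type*} [Fintype X] [Fintype M] [Fintype M'] [Fintype Xhat] [Nonempty Xhat]
    (T : X → stdSimplex ℝ X) (O : M → stdSimplex ℝ M') (d : X → Xhat → ℝ≥0)
    (β : ℝ) (hβ0 : 0 < β) (hβ1 : β < 1)
    (q : (N : ℕ+) → stdSimplex ℝ X → Grid X N)
    (hq : ∀ N, Measurable (q N))
    (hnn : ∀ N, IsNearestNeighbor (q N))
    (ν : ℕ+ → Measure (stdSimplex ℝ X)) [∀ N, IsProbabilityMeasure (ν N)]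
    (hν : ∀ (N : ℕ+) (p : Grid X N), 0 < ν N (q N ⁻¹' {p}))
    (γhat : (N : ℕ+) → Grid X N → Quantizer X M)
    (hopt : ∀ N, ((beliefMDP T O d).quantize (q N) (hq N) (ν N) (hν N)).IsOptimal β
      (Policy.stationary (γhat N) Measurable.of_discrete))
    (π₀ : stdSimplex ℝ X) :
    ((∀ N, (beliefMDP T O d).discountedCost β π₀
        (Policy.stationary (fun π => γhat N (q N π))
          (Measurable.of_discrete.comp (hq N))) ≠ ∞) ∧
      (beliefMDP T O d).optimalCost β π₀ ≠ ∞ ∧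
      Tendsto (fun N : ℕ+ =>
        |((beliefMDP T O d).discountedCost β π₀
            (Policy.stationary (fun π => γhat N (q N π))
              (Measurable.of_discrete.comp (hq N)))).toReal -
          ((beliefMDP T O d).optimalCost β π₀).toReal|) atTop (𝓝 0)) ∧
    (∀ ε : ℝ, 0 < ε → ∀ᶠ N : ℕ+ in atTop,
      encoderDistortion T O d β π₀
          (walrandVaraiyaEncoder T O π₀ (fun π => γhat N (q N π))) ≤
        optimalDistortion T O d β π₀ + ENNReal.ofReal ε) := by
  classical
  have hX : Nonempty X := by
    by_contra h
    rw [not_nonempty_iff] at h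
    simpa using π₀.2.2
  have hM : Nonempty M := ⟨γhat 1 (q 1 π₀) hX.some⟩
  have : Nonempty (Quantizer X M) := ⟨γhat 1 (q 1 π₀)⟩
  let _ : Fintype (Quantizer X M) := Fintype.ofFinite _
  have hβ : 0 < 1 - β := sub_pos.2 hβ1
  obtain ⟨D, hD0, hD⟩ := exists_distortion_bound d
  obtain ⟨W, hreg, hW⟩ := exists_regular_bellman_fixedPoint T O d hβ0.le hβ1 hD hD0
  set K : ℝ := D / (1 - β) with hKdef
  have hK : 0 ≤ K := by positivity
  have hDK : D + β * K = K := by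
    rw [hKdef]
    field_simp
    ring
  have hWnn : 0 ≤ W π₀.1 := hreg.nonneg _ π₀.2.1
  -- `k N` is the greedy error for bins of diameter `4 * card X ^ 2 / N`; below, `A N = k N / (1 -
  -- β)` is its discounted accumulation.
  set k : ℕ+ → ℝ := fun N => 3 * (2 * (K * (4 * (Fintype.card X : ℝ) ^ 2 / (N : ℝ))) / (1 - β))
    with hk
  set A : ℕ+ → ℝ := fun N => k N / (1 - β) with hA
  have hk0 : ∀ N, 0 ≤ k N := fun N => by simp only [hk]; positivity
  have hA0 : ∀ N, 0 ≤ A N := fun N => div_nonneg (hk0 N) hβ.le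
  have hkA : ∀ N, k N + β * A N = A N := fun N => by
    simp only [hA]
    field_simp
    ring
  have hAlim : Tendsto A atTop (𝓝 0) := by
    have h1 : Tendsto (fun N : ℕ+ => (N : ℝ)) atTop atTop :=
      tendsto_natCast_atTop_atTop.comp tendsto_PNat_val_atTop_atTop
    have h2 := h1.const_div_atTop
      (3 * (2 * (K * (4 * (Fintype.card X : ℝ) ^ 2)) / (1 - β)) / (1 - β))
    refine h2.congr fun N => ?_
    simp only [hA, hk]
    ring
  have hgreedy : ∀ N (π : stdSimplex ℝ X),
      qValue T O d β W π.1 (γhat N (q N π)) ≤ W π.1 + k N := fun N =>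
    hreg.qValue_optimal_quantize_le T O d hβ0.le hβ1 hD hK hDK hW (hq N) (ν N) (hν N)
      (by positivity) (fun _ _ h => (hnn N).ell1_sub_le h) (hopt N)
  have hJ : ∀ N, (beliefMDP T O d).discountedCost β π₀ (Policy.stationary
      (fun π => γhat N (q N π)) (Measurable.of_discrete.comp (hq N))) ≤
      ENNReal.ofReal (W π₀.1 + A N) := by
    intro N
    rw [ENNReal.ofReal_add hWnn (hA0 N)]
    refine MDP.discountedCost_stationary_le_add (beliefMDP T O d) hβ0.le
      (V := fun π => ENNReal.ofReal (W π.1))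
      ((hreg.measurable hK).comp measurable_subtype_coe).ennreal_ofReal
      (Measurable.of_discrete.comp (hq N)) (k := ENNReal.ofReal (k N)) ?_ (fun π => ?_) π₀
    · rw [← ENNReal.ofReal_mul hβ0.le, ← ENNReal.ofReal_add (hk0 N)
        (mul_nonneg hβ0.le (hA0 N)), hkA]
    · rw [actionValue_beliefMDP T O d hβ0.le hreg hK,
        ← ENNReal.ofReal_add (hreg.nonneg _ π.2.1) (hk0 N)]
      exact ENNReal.ofReal_le_ofReal (hgreedy N π)
  have hlow := hreg.le_optimalCost_beliefMDP T O d hβ0.le hβ1 hK hW π₀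
  have hle : ∀ N, (beliefMDP T O d).optimalCost β π₀ ≤ (beliefMDP T O d).discountedCost β π₀
      (Policy.stationary (fun π => γhat N (q N π)) (Measurable.of_discrete.comp (hq N))) :=
    fun N => iInf_le _ _
  have hJfin : ∀ N, (beliefMDP T O d).discountedCost β π₀ (Policy.stationary
      (fun π => γhat N (q N π)) (Measurable.of_discrete.comp (hq N))) ≠ ∞ := fun N =>
    ne_top_of_le_ne_top ENNReal.ofReal_ne_top (hJ N)
  have hoptfin : (beliefMDP T O d).optimalCost β π₀ ≠ ∞ := ne_top_of_le_ne_top (hJfin 1) (hle 1)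
  refine ⟨⟨hJfin, hoptfin, ?_⟩, fun ε hε => ?_⟩
  -- The optimal cost and the policy's cost both lie between `W π₀` and `W π₀ + A N`.
  · refine squeeze_zero (fun _ => abs_nonneg _) (fun N => ?_) hAlim
    have h1 := ENNReal.toReal_mono (hJfin N) (hle N)
    have h2 := ENNReal.toReal_mono ENNReal.ofReal_ne_top (hJ N)
    have h3 := ENNReal.toReal_mono hoptfin hlow
    rw [ENNReal.toReal_ofReal (add_nonneg hWnn (hA0 N))] at h2
    rw [ENNReal.toReal_ofReal hWnn] at h3
    rw [abs_of_nonneg (sub_nonneg.2 h1)]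
    linarith
  · filter_upwards [hAlim.eventually_le_const hε] with N hN
    refine (hreg.encoderDistortion_le T O d π₀ (fun π => γhat N (q N π)) hβ0.le hK (hA0 N)
      (hkA N).le (hgreedy N)).trans ?_
    rw [ENNReal.ofReal_add hWnn (hA0 N)]
    refine add_le_add (le_iInf fun γe => le_iInf fun γd => ?_) (ENNReal.ofReal_le_ofReal hN)
    exact hreg.le_discountedDistortion T O d π₀ hβ0.le hβ1 hK hW γe γd
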